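/- **Setting.** Let $A,S\in\mathbb R^{n\times n}$, $B\in\mathbb R^{n\times d}$, $R\in\mathbb R^{d\times d}$ with $S,R$ symmetric positive definite, and let $\sigma>0$. Let $\omega_t\sim N(0,D_\omega)$ and $\eta_t\sim N(0,\sigma^2I_d)$, $t=0,1,2,\dots$, all be independent, put $\widetilde\omega_t=B\eta_t+\omega_t$, and assume that $D_{\widetilde\omega}=\mathbb E[\widetilde\omega_t\widetilde\omega_t^\top]$ is positive definite. For a gain $K\in\mathbb R^{d\times n}$ and $\gamma\in(0,1)$ consider $x_0=0$, $u_t=Kx_t+\eta_t$, $x_{t+1}=Ax_t+Bu_t+\omega_t$, the cost $c_t=x_t^\top Sx_t+u_t^\top Ru_t$, and $$J(K)=\sum_{t\ge0}\gamma^t\,\mathbb E[c_t]\in[0,\infty],\qquad \Sigma_{K,\gamma}=\sum_{t\ge 0}\mathbb E[\gamma^t x_tx_t^\top].$$ $K$ is *stable* if the spectral radius of $A+BK$ is less than $1$. $K^*$ denotes a global minimizer of $J$ over $\mathbb R^{d\times n}$, and $$\mathbf{Dom}_{K,\nu}=\{\tilde K:\ J(\tilde K)<\infty,\ J(\tilde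 K)-J(K^*)\le\nu\,(J(K)-J(K^*))\}.$$ For stable $K$, let $Q_K(x,u)=\mathbb E[\sum_{t\ge0}\gamma^tc_t\mid x_0=x,u_0=u]$ (with $u_t=Kx_t+\eta_t$ for $t\ge1$); its parameters are the symmetric matrix $\Theta^*_K\in\mathbb R^{(n+d)\times(n+d)}$ and the constant $\Theta^*_{K,0}$ with $$Q_K(x,u)=\begin{bmatrix}x\\u\end{bmatrix}^{\!\top}\Theta^*_K\begin{bmatrix}x\\u\end{bmatrix}+\Theta^*_{K,0}\quad\text{for all }x,u.$$ A matrix $\Theta=\begin{bmatrix}\Theta_{11}&\Theta_{12}\\ \Theta_{21}&\Theta_{22}\end{bmatrix}$ is an $\epsilon_0$-approximation for $K$ if $\|\Theta-\Theta_K^*\|_F\le\epsilon_0$. *Approximate policy iteration* from $K^{(0)}$ takes, at each step $s=0,1,\dots,T-1$, an $\epsilon_0$-approximation $\Theta^{(s)}$ for the current policy $K^{(s)}$ and sets $K^{(s+1)}=-(\Theta^{(s)}_{22})^{-1}\Theta^{(s)}_{21}$. Here $\|\cdot\|_2$ is the spectral norm and $\sigma_{\min}$ the smallest singular value. **Theorem.**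 There is a positive function $C_1$ of six real variables, the same for all $n,d$ and all systems as above, such that the following holds. For every system as above and every stable $K^{(0)}$ there is $\gamma_0\in(0,1)$ such that for all $\gamma\in(\gamma_0,1)$, every optimal $K^*$, every $\epsilon$ with $0<\epsilon\le J(K^{(0)})-J(K^*)$, every $\epsilon_0$ with $$\epsilon_0\le\min\left\{\frac1{2\|R^{-1}\|_2},\ \frac{C_1\sqrt\epsilon}{\sqrt{\|\Sigma_{K^*,\gamma}\|_2}\,J(K^*)}\right\},$$ where $$C_1=C_1\big(\sigma_{\min}(D_{\widetilde\omega}),\sigma_{\min}(S),\|R^{-1}\|_2,\|A\|_2,\|B\|_2,(1-\gamma)J(K^{(0)})\big),$$ and every integer $T\ge0$ with $$T\ge\left[\frac{2\|\Sigma_{K^*,\gamma}\|_2}{\gamma^2\sigma_{\min}(D_{\widetilde\omega})}-1\right]\log\frac{J(K^{(0)})-J(K^*)}{\epsilon},$$ every run of $T$ steps of approximate policy iteration from $K^{(0)}$ is well defined (all $\Theta_{22}^{(s)}$, $0\le s<T$, are invertible), the policies $K^{(1)},\dots,K^{(T)}$ are stable and belong to $\mathbf{Dom}_{K^{(0)},2}$,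 and $$J(K^{(T)})-J(K^*)\le\epsilon .$$ -/

import Mathlib

open Matrix MeasureTheory ProbabilityTheory
open scoped ENNReal

noncomputable section

/-- The spectral norm `‖M‖₂` of a real matrix (operator norm for the Euclidean norms). -/
def specNorm {m k : ℕ} (M : Matrix (Fin m) (Fin k) ℝ) : ℝ :=
  @norm _ Matrix.instL2OpNormedAddCommGroup.toNorm M

/-- The Frobenius norm. -/
def frobNorm {ι κ : Type*} [Fintype ι] [Fintype κ] (M : Matrix ι κ ℝ) : ℝ :=
  √(∑ i, ∑ j, M i j ^ 2)

/-- The smallest singular value of a square matrix, as the minimum of `‖M x‖` over Euclidean unit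
vectors. -/
def sigmaMin {m : ℕ} (M : Matrix (Fin m) (Fin m) ℝ) : ℝ :=
  sInf {r | ∃ x : EuclideanSpace ℝ (Fin m), ‖x‖ = 1 ∧ r = ‖Matrix.toEuclideanLin M x‖}

/-- The data of a linear quadratic regulator with Gaussian policies: the system matrices `A`, `B`,
the cost matrices `S`, `R`, the standard deviation `σ` of the policy, the covariance `Dω` of the
system noise, the system noise `ω t`, the exploration noise `η t`, and the underlying measure. -/
structure LQR (n d : ℕ) (Ω : Type*) [MeasurableSpace Ω] where
  A : Matrix (Fin n) (Fin n) ℝ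
  B : Matrix (Fin n) (Fin d) ℝ
  S : Matrix (Fin n) (Fin n) ℝ
  R : Matrix (Fin d) (Fin d) ℝ
  σ : ℝ
  Dω : Matrix (Fin n) (Fin n) ℝ
  ω : ℕ → Ω → EuclideanSpace ℝ (Fin n)
  η : ℕ → Ω → EuclideanSpace ℝ (Fin d)
  P : Measure Ω

namespace LQR

variable {n d : ℕ} {Ω : Type*} [MeasurableSpace Ω] (L : LQR n d Ω)

/-- The noise `ω̃ₜ = B ηₜ + ωₜ` of the closed loop system. -/
def noiseTilde (t : ℕ) (w : Ω) : Fin n → ℝ := L.B *ᵥ (L.η t w).ofLp + (L.ω t w).ofLp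

/-- `D_ω̃ = E[ω̃ₜ ω̃ₜᵀ]` (the noise is identically distributed, so `t = 0` is taken). -/
def DTilde : Matrix (Fin n) (Fin n) ℝ :=
  Matrix.of fun i j => ∫ w, L.noiseTilde 0 w i * L.noiseTilde 0 w j ∂L.P

/-- The standing assumptions: positive definite costs, `σ > 0`, Gaussian noise `ωₜ ∼ N(0, Dω)` and
`ηₜ ∼ N(0, σ² I)`, all of these random vectors being independent, and `D_ω̃` positive definite. -/
structure Standing : Prop where
  prob : IsProbabilityMeasure L.P
  posDef_S : L.S.PosDef
  posDef_R : L.R.PosDef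
  sigma_pos : 0 < L.σ
  posSemidef_D : L.Dω.PosSemidef
  law_ω : ∀ t, HasLaw (L.ω t) (multivariateGaussian 0 L.Dω) L.P
  law_η : ∀ t, HasLaw (L.η t)
    (multivariateGaussian 0 (L.σ ^ 2 • (1 : Matrix (Fin d) (Fin d) ℝ))) L.P
  indep_time : iIndepFun (fun t w => (L.ω t w, L.η t w)) L.P
  indep_noise : ∀ t, IndepFun (L.ω t) (L.η t) L.P
  posDef_DTilde : L.DTilde.PosDef

/-- A gain `K` is stable if `ρ(A + B K) < 1`, with `ρ` the (complex) spectral radius. -/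
def Stable (K : Matrix (Fin d) (Fin n) ℝ) : Prop :=
  spectralRadius ℂ ((L.A + L.B * K).map (algebraMap ℝ ℂ)) < 1

/-- The state-action trajectory `(xₜ, uₜ)` with the given (random) initial pair, the dynamics
`xₜ₊₁ = A xₜ + B uₜ + ωₜ` and, from time `1` on, the Gaussian policy `uₜ = K xₜ + ηₜ`. -/
def traj (K : Matrix (Fin d) (Fin n) ℝ) (init : Ω → (Fin n → ℝ) × (Fin d → ℝ)) :
    ℕ → Ω → (Fin n → ℝ) × (Fin d → ℝ)
  | 0, w => init w
  | t + 1, w =>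
      let x : Fin n → ℝ :=
        L.A *ᵥ (traj K init t w).1 + L.B *ᵥ (traj K init t w).2 + (L.ω t w).ofLp
      (x, K *ᵥ x + (L.η (t + 1) w).ofLp)

/-- The one-step cost `xᵀ S x + uᵀ R u`. -/
def stageCost (z : (Fin n → ℝ) × (Fin d → ℝ)) : ℝ :=
  z.1 ⬝ᵥ (L.S *ᵥ z.1) + z.2 ⬝ᵥ (L.R *ᵥ z.2)

/-- The expected discounted cumulative cost `∑ₜ E[γᵗ cₜ]`, possibly infinite. -/
def discCost (γ : ℝ) (K : Matrix (Fin d) (Fin n) ℝ)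
    (init : Ω → (Fin n → ℝ) × (Fin d → ℝ)) : ℝ≥0∞ :=
  ∑' t, ∫⁻ w, ENNReal.ofReal (γ ^ t * L.stageCost (L.traj K init t w)) ∂L.P

/-- The initial pair `x₀ = 0`, `u₀ = K x₀ + η₀` of the policy optimization problem. -/
def startZero (K : Matrix (Fin d) (Fin n) ℝ) (w : Ω) : (Fin n → ℝ) × (Fin d → ℝ) :=
  (0, K *ᵥ 0 + (L.η 0 w).ofLp)

/-- The objective `J(K)` as an extended nonnegative number. -/
def JExt (γ : ℝ) (K : Matrix (Fin d) (Fin n) ℝ) : ℝ≥0∞ := L.discCost γ K (L.startZero K)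

/-- The objective `J(K)` as a real number (meaningful where `JExt` is finite). -/
def J (γ : ℝ) (K : Matrix (Fin d) (Fin n) ℝ) : ℝ := (L.JExt γ K).toReal

/-- `K` is an optimal policy: a global minimizer of `J` over all gains. -/
def IsOptimal (γ : ℝ) (K : Matrix (Fin d) (Fin n) ℝ) : Prop :=
  ∀ K', L.JExt γ K ≤ L.JExt γ K'

/-- The set `{K̃ | J(K̃) - J(K*) ≤ ν (J(K) - J(K*))}`; gains of infinite cost are not in it. -/
def DomLevel (γ : ℝ) (Kstar K : Matrix (Fin d) (Fin n) ℝ) (ν : ℝ) :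
    Set (Matrix (Fin d) (Fin n) ℝ) :=
  {K' | L.JExt γ K' ≠ ∞ ∧ L.J γ K' - L.J γ Kstar ≤ ν * (L.J γ K - L.J γ Kstar)}

/-- `Σ_{K,γ} = ∑ₜ E[γᵗ xₜ xₜᵀ]` along the trajectory of the policy `K` with `x₀ = 0`. -/
def SigmaMat (γ : ℝ) (K : Matrix (Fin d) (Fin n) ℝ) : Matrix (Fin n) (Fin n) ℝ :=
  Matrix.of fun i j => ∑' t : ℕ, ∫ w, γ ^ t *
    ((L.traj K (L.startZero K) t w).1 i * (L.traj K (L.startZero K) t w).1 j) ∂L.P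

/-- The state-action value `Q_K(x, u)`: expected discounted cost from `x₀ = x`, `u₀ = u`. -/
def Q (γ : ℝ) (K : Matrix (Fin d) (Fin n) ℝ) (x : Fin n → ℝ) (u : Fin d → ℝ) : ℝ≥0∞ :=
  L.discCost γ K (fun _ => (x, u))

/-- The quadratic functions `Q̃(x, u; Θ) = [xᵀ uᵀ] Θ [x; u] + Θ₀`. -/
def QTilde (Θ : Matrix (Fin n ⊕ Fin d) (Fin n ⊕ Fin d) ℝ) (Θ₀ : ℝ)
    (x : Fin n → ℝ) (u : Fin d → ℝ) : ℝ :=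
  Sum.elim x u ⬝ᵥ (Θ *ᵥ Sum.elim x u) + Θ₀

/-- `(Θ, Θ₀)` are the parameters of `Q_K`, where `Θ` is the symmetric matrix of the quadratic
part. -/
def IsQParam (γ : ℝ) (K : Matrix (Fin d) (Fin n) ℝ)
    (Θ : Matrix (Fin n ⊕ Fin d) (Fin n ⊕ Fin d) ℝ) (Θ₀ : ℝ) : Prop :=
  Θ.IsSymm ∧ ∀ x u, L.Q γ K x u ≠ ∞ ∧ (L.Q γ K x u).toReal = QTilde Θ Θ₀ x u

/-- `Θ` is an `ε₀`-approximation of the parameters of `Q_K`. The approximation need not be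
symmetric, and nothing is asked of the constant term, which the policy update does not use. -/
def IsApproxQ (γ ε₀ : ℝ) (K : Matrix (Fin d) (Fin n) ℝ)
    (Θ : Matrix (Fin n ⊕ Fin d) (Fin n ⊕ Fin d) ℝ) : Prop :=
  ∃ Θs Θs₀, L.IsQParam γ K Θs Θs₀ ∧ frobNorm (Θ - Θs) ≤ ε₀

/-- A run of `T` steps of approximate policy iteration: whenever the current policy is stable, the
evaluation step returns an `ε₀`-approximation `Θ s` of the parameters of its state-action value
function, and the improvement step is `K (s+1) = -Θ₂₂⁻¹ Θ₂₁`. -/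
def IsPolicyIteration (γ ε₀ : ℝ) (T : ℕ) (K : ℕ → Matrix (Fin d) (Fin n) ℝ)
    (Θ : ℕ → Matrix (Fin n ⊕ Fin d) (Fin n ⊕ Fin d) ℝ) : Prop :=
  ∀ s < T, (L.Stable (K s) → L.IsApproxQ γ ε₀ (K s) (Θ s)) ∧
    K (s + 1) = -((Θ s).toBlocks₂₂⁻¹ * (Θ s).toBlocks₂₁)

end LQR

end

/-! For a stable gain K let P be its cost-to-go matrix, the solution of P = `bellman` P K.
Completing the square, `bellman` P K' is a matrix independent of K' plus `gap` P K' = (K' - g)ᵀ G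
(K' - g), where G = R + γ Bᵀ P B and g is the greedy gain. Testing the Lyapunov equation of Σ_{K'}
against P gives the exact cost difference `J_sub_J`: J(K') - J(K) = tr(gap(K') Σ_{K'}) - tr(gap(K)
Σ_{K'}).

Write σ and s for the smallest singular values of D_ω̃ and S. For K' = K* the identity yields J(K) -
J(K*) ≤ ‖Σ_{K*}‖ tr gap(K). For K' the next iterate, Σ_{K'} ≥ γσ/(1-γ) I makes the second term at
least γσ/(1-γ) tr gap(K). Hence the excess cost contracts by 1 - ρ with ρ = γσ/((1-γ)‖Σ_{K*}‖), up
to the error tr(gap(K') Σ_{K'}). Here gap(K') is of order ε₀² (`improvement`) and tr Σ_{K'} ≤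
2J(K)/s. The constant C₁ makes this error at most ρε/2 (`approximation_loss_le`), so after t steps
the excess is at most max(ε, (1 - ρ/2)^t Δ), where Δ is the initial excess; `two_div_rate_le`
converts the rate into the stated number of steps.

Stability has to be propagated too, because a finite discounted cost does not imply it. The matrix P
of K is a Lyapunov function for K': P - γ(A+BK')ᵀP(A+BK') ≥ (s/2) I. Replacing γ by 1 costs (1-γ)P,
and tr P is controlled by (1-γ)J(K). Along the run this is at most (1-γ)J(K⁽⁰⁾), which is bounded
uniformly in γ (`exists_average_cost_bound`). This determines γ₀. -/

section LinearAlgebra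

/-! ### Quadratic forms, traces and norms of matrices. -/

theorem dot_vecMulVec_mul {n : ℕ} (X : Matrix (Fin n) (Fin n) ℝ) (v : Fin n → ℝ) :
    (X * vecMulVec v v).trace = v ⬝ᵥ (X *ᵥ v) := by
  rw [mul_vecMulVec, trace_vecMulVec, dotProduct_comm]

/-- A positive semidefinite M is a sum of matrices v vᵀ, and each contributes vᵀ X v. -/
theorem trace_mul_nonneg {n : ℕ} {X M : Matrix (Fin n) (Fin n) ℝ} (hX : X.PosSemidef)
    (hM : M.PosSemidef) : 0 ≤ (X * M).trace := by
  obtain ⟨m, v, rfl⟩ := posSemidef_iff_eq_sum_vecMulVec.mp hM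
  rw [Finset.mul_sum, trace_sum]
  refine Finset.sum_nonneg fun i _ => ?_
  have := hX.dotProduct_mulVec_nonneg (v i)
  rw [star_trivial] at this ⊢
  rwa [dot_vecMulVec_mul]

theorem trace_mul_le_trace_mul {n : ℕ} {X M N : Matrix (Fin n) (Fin n) ℝ} (hX : X.PosSemidef)
    (h : (N - M).PosSemidef) : (X * M).trace ≤ (X * N).trace := by
  have := trace_mul_nonneg hX h
  rw [mul_sub, trace_sub] at this
  linarith

theorem posSemidef_of_isSymm {n : ℕ} {M : Matrix (Fin n) (Fin n) ℝ} (hM : M.IsSymm)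
    (h : ∀ x, 0 ≤ x ⬝ᵥ (M *ᵥ x)) : M.PosSemidef :=
  .of_dotProduct_mulVec_nonneg (by simpa [Matrix.IsHermitian] using hM.eq)
    (by simpa only [star_trivial] using h)

theorem Matrix.PosSemidef.isSymm {n : ℕ} {M : Matrix (Fin n) (Fin n) ℝ}
    (hM : M.PosSemidef) : M.IsSymm := by
  have h := hM.1.eq
  rwa [conjTranspose_eq_transpose_of_trivial] at h

theorem Matrix.PosSemidef.dot_nonneg {n : ℕ} {M : Matrix (Fin n) (Fin n) ℝ}
    (hM : M.PosSemidef) (x : Fin n → ℝ) : 0 ≤ x ⬝ᵥ (M *ᵥ x) := by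
  simpa only [star_trivial] using hM.dotProduct_mulVec_nonneg x

theorem dot_mulVec_transpose {m k : ℕ} (M : Matrix (Fin m) (Fin k) ℝ) (x : Fin k → ℝ)
    (y : Fin m → ℝ) : x ⬝ᵥ (Mᵀ *ᵥ y) = (M *ᵥ x) ⬝ᵥ y := by
  rw [mulVec_transpose, dotProduct_comm, ← dotProduct_mulVec, dotProduct_comm]

theorem dot_conj_mulVec {m k : ℕ} (M : Matrix (Fin m) (Fin m) ℝ) (C : Matrix (Fin m) (Fin k) ℝ)
    (x : Fin k → ℝ) : x ⬝ᵥ ((Cᵀ * M * C) *ᵥ x) = (C *ᵥ x) ⬝ᵥ (M *ᵥ (C *ᵥ x)) := by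
  rw [← mulVec_mulVec, ← mulVec_mulVec, dot_mulVec_transpose]

theorem Matrix.IsSymm.dot_comm {n : ℕ} {M : Matrix (Fin n) (Fin n) ℝ}
    (hM : M.IsSymm) (x y : Fin n → ℝ) : x ⬝ᵥ (M *ᵥ y) = y ⬝ᵥ (M *ᵥ x) := by
  conv_lhs => rw [← hM, dot_mulVec_transpose, dotProduct_comm]

theorem Matrix.PosSemidef.conj {m k : ℕ} {M : Matrix (Fin m) (Fin m) ℝ}
    (hM : M.PosSemidef) (C : Matrix (Fin m) (Fin k) ℝ) : (Cᵀ * M * C).PosSemidef := by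
  simpa using hM.conjTranspose_mul_mul_same C

theorem Matrix.PosSemidef.conj' {m k : ℕ} {M : Matrix (Fin m) (Fin m) ℝ}
    (hM : M.PosSemidef) (C : Matrix (Fin k) (Fin m) ℝ) : (C * M * Cᵀ).PosSemidef := by
  simpa using hM.mul_mul_conjTranspose_same C

theorem dot_self_nonneg {n : ℕ} (x : Fin n → ℝ) : 0 ≤ x ⬝ᵥ x :=
  Finset.sum_nonneg fun _ _ => mul_self_nonneg _

theorem dot_self_pos {n : ℕ} {x : Fin n → ℝ} (hx : x ≠ 0) : 0 < x ⬝ᵥ x :=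
  (dot_self_nonneg x).lt_of_ne fun h => hx (dotProduct_self_eq_zero.mp h.symm)

theorem norm_sq_eq_dot {n : ℕ} (x : EuclideanSpace ℝ (Fin n)) : ‖x‖ ^ 2 = x.ofLp ⬝ᵥ x.ofLp := by
  rw [EuclideanSpace.norm_sq_eq]
  simp [dotProduct, sq]

theorem dot_sq_le {n : ℕ} (x y : Fin n → ℝ) : (x ⬝ᵥ y) ^ 2 ≤ (x ⬝ᵥ x) * (y ⬝ᵥ y) := by
  simpa [dotProduct, sq] using Finset.sum_mul_sq_le_sq_mul_sq Finset.univ x y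

/-- Inverting a form inequality without diagonalization: expand the nonnegative value of the form M
at y - c⁻¹ M⁻¹ y. -/
theorem dot_self_le_of_inv {n : ℕ} {M : Matrix (Fin n) (Fin n) ℝ} (hM : M.PosDef) {c : ℝ}
    (hc : 0 < c) (h : ∀ x, x ⬝ᵥ (M⁻¹ *ᵥ x) ≤ c * (x ⬝ᵥ x)) (y : Fin n → ℝ) :
    y ⬝ᵥ y ≤ c * (y ⬝ᵥ (M *ᵥ y)) := by
  have hu : IsUnit M.det := (Matrix.isUnit_iff_isUnit_det M).mp hM.isUnit
  have h1 := hM.posSemidef.dot_nonneg (y - c⁻¹ • (M⁻¹ *ᵥ y))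
  have e : M *ᵥ (M⁻¹ *ᵥ y) = y := by rw [mulVec_mulVec, mul_nonsing_inv _ hu, one_mulVec]
  have e2 : (M⁻¹ *ᵥ y) ⬝ᵥ (M *ᵥ y) = y ⬝ᵥ y := by
    rw [hM.posSemidef.isSymm.dot_comm, e]
  rw [mulVec_sub, mulVec_smul, e, sub_dotProduct, dotProduct_sub, dotProduct_sub, smul_dotProduct,
    smul_dotProduct, dotProduct_smul, dotProduct_smul, e2, dotProduct_comm (M⁻¹ *ᵥ y) y] at h1
  have h2 := h y
  simp only [smul_eq_mul] at h1
  have h3 : c⁻¹ * (c⁻¹ * (y ⬝ᵥ (M⁻¹ *ᵥ y))) ≤ c⁻¹ * (y ⬝ᵥ y) := by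
    have := mul_le_mul_of_nonneg_left h2 (inv_pos.mpr hc).le
    rw [inv_mul_cancel_left₀ hc.ne'] at this
    exact mul_le_mul_of_nonneg_left this (inv_pos.mpr hc).le
  have h4 : c⁻¹ * (y ⬝ᵥ y) ≤ y ⬝ᵥ (M *ᵥ y) := by linarith
  rwa [inv_mul_le_iff₀ hc] at h4

theorem specNorm_nonneg {m k : ℕ} (M : Matrix (Fin m) (Fin k) ℝ) : 0 ≤ specNorm M := by
  unfold specNorm
  exact @norm_nonneg _ Matrix.instL2OpNormedAddCommGroup.toSeminormedAddCommGroup.toSeminormedAddGroup M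

theorem norm_toEuclideanLin_le {m k : ℕ} (M : Matrix (Fin m) (Fin k) ℝ)
    (x : EuclideanSpace ℝ (Fin k)) : ‖Matrix.toEuclideanLin M x‖ ≤ specNorm M * ‖x‖ :=
  Matrix.l2_opNorm_mulVec M x

theorem mulVec_dot_self_le {m k : ℕ} (M : Matrix (Fin m) (Fin k) ℝ) (v : Fin k → ℝ) :
    (M *ᵥ v) ⬝ᵥ (M *ᵥ v) ≤ specNorm M ^ 2 * (v ⬝ᵥ v) := by
  have h := norm_toEuclideanLin_le M (WithLp.toLp 2 v)
  have h2 := pow_le_pow_left₀ (norm_nonneg _) h 2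
  rw [mul_pow, norm_sq_eq_dot, norm_sq_eq_dot] at h2
  simpa using h2

theorem dot_mulVec_le_specNorm {k : ℕ} (M : Matrix (Fin k) (Fin k) ℝ) (v : Fin k → ℝ) :
    v ⬝ᵥ (M *ᵥ v) ≤ specNorm M * (v ⬝ᵥ v) := by
  refine abs_le_of_sq_le_sq' ?_ (mul_nonneg (specNorm_nonneg M) (dot_self_nonneg v)) |>.2
  calc _ ≤ (v ⬝ᵥ v) * ((M *ᵥ v) ⬝ᵥ (M *ᵥ v)) := dot_sq_le _ _
    _ ≤ (v ⬝ᵥ v) * (specNorm M ^ 2 * (v ⬝ᵥ v)) :=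
      mul_le_mul_of_nonneg_left (mulVec_dot_self_le M v) (dot_self_nonneg v)
    _ = _ := by ring

theorem specNorm_inv_pos {k : ℕ} [Nonempty (Fin k)] {M : Matrix (Fin k) (Fin k) ℝ}
    (hM : M.PosDef) : 0 < specNorm M⁻¹ := by
  refine (specNorm_nonneg _).lt_of_ne fun h => ?_
  let i : Fin k := Classical.arbitrary _
  have h1 := dot_mulVec_le_specNorm M⁻¹ (Pi.single i 1)
  have h2 := hM.inv.diag_pos (i := i)
  rw [← h] at h1
  simp at h1
  linarith

theorem dot_self_le_specNorm_inv {k : ℕ} {M : Matrix (Fin k) (Fin k) ℝ}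
    (hM : M.PosDef) (y : Fin k → ℝ) : y ⬝ᵥ y ≤ specNorm M⁻¹ * (y ⬝ᵥ (M *ᵥ y)) := by
  rcases isEmpty_or_nonempty (Fin k) with h | h
  · simp [dotProduct]
  · exact dot_self_le_of_inv hM (specNorm_inv_pos hM) (dot_mulVec_le_specNorm _) y

theorem sigmaMin_mul_norm_le {k : ℕ} (M : Matrix (Fin k) (Fin k) ℝ)
    (x : EuclideanSpace ℝ (Fin k)) : sigmaMin M * ‖x‖ ≤ ‖Matrix.toEuclideanLin M x‖ := by
  rcases eq_or_ne x 0 with rfl | hx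
  · simp
  have hx' := norm_pos_iff.mpr hx
  rw [← le_div_iff₀ hx']
  refine csInf_le ⟨0, ?_⟩ ⟨‖x‖⁻¹ • x, ?_, ?_⟩
  · rintro r ⟨y, -, rfl⟩
    exact norm_nonneg _
  · rw [norm_smul, norm_inv, norm_norm, inv_mul_cancel₀ hx'.ne']
  · rw [map_smul, norm_smul, norm_inv, norm_norm, div_eq_inv_mul]

theorem sigmaMin_pos {k : ℕ} [Nonempty (Fin k)] {M : Matrix (Fin k) (Fin k) ℝ}
    (hM : M.PosDef) : 0 < sigmaMin M := by
  have hu : IsUnit M.det := (Matrix.isUnit_iff_isUnit_det M).mp hM.isUnit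
  have hp := specNorm_inv_pos hM
  refine (inv_pos.mpr hp).trans_le (le_csInf ?_ ?_)
  · exact ⟨_, EuclideanSpace.single (Classical.arbitrary _) 1, by simp, rfl⟩
  · rintro r ⟨x, hx, rfl⟩
    rw [inv_le_iff_one_le_mul₀' hp, ← hx]
    have h := norm_toEuclideanLin_le M⁻¹ (Matrix.toEuclideanLin M x)
    rwa [Matrix.toLpLin_apply, Matrix.toLpLin_apply, mulVec_mulVec, nonsing_inv_mul _ hu, one_mulVec,
      WithLp.toLp_ofLp] at h

/-- The bound on ‖M x‖ at x = M⁻¹ y controls ‖M⁻¹ y‖, hence the form of M⁻¹ by Cauchy–Schwarz;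
`dot_self_le_of_inv` then passes to M. -/
theorem sigmaMin_mul_dot_le {k : ℕ} [Nonempty (Fin k)] {M : Matrix (Fin k) (Fin k) ℝ}
    (hM : M.PosDef) (y : Fin k → ℝ) : sigmaMin M * (y ⬝ᵥ y) ≤ y ⬝ᵥ (M *ᵥ y) := by
  have hs := sigmaMin_pos hM
  have hu : IsUnit M.det := (Matrix.isUnit_iff_isUnit_det M).mp hM.isUnit
  rw [← le_inv_mul_iff₀ hs]
  refine dot_self_le_of_inv hM (inv_pos.mpr hs) (fun x => ?_) y
  have h := sigmaMin_mul_norm_le M (WithLp.toLp 2 (M⁻¹ *ᵥ x))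
  rw [← le_inv_mul_iff₀ hs] at h
  have h2 := pow_le_pow_left₀ (norm_nonneg _) h 2
  rw [mul_pow, norm_sq_eq_dot, norm_sq_eq_dot] at h2
  simp only [Matrix.toLpLin_apply, mulVec_mulVec, mul_nonsing_inv _ hu, one_mulVec] at h2
  refine abs_le_of_sq_le_sq' ?_ (mul_nonneg (inv_pos.mpr hs).le (dot_self_nonneg x)) |>.2
  calc _ ≤ (x ⬝ᵥ x) * ((M⁻¹ *ᵥ x) ⬝ᵥ (M⁻¹ *ᵥ x)) := dot_sq_le _ _
    _ ≤ (x ⬝ᵥ x) * ((sigmaMin M)⁻¹ ^ 2 * (x ⬝ᵥ x)) :=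
      mul_le_mul_of_nonneg_left h2 (dot_self_nonneg x)
    _ = _ := by ring

theorem posSemidef_sub_smul_one {k : ℕ} {M : Matrix (Fin k) (Fin k) ℝ} (hM : M.IsSymm) {c : ℝ}
    (h : ∀ y, c * (y ⬝ᵥ y) ≤ y ⬝ᵥ (M *ᵥ y)) : (M - c • 1).PosSemidef := by
  refine posSemidef_of_isSymm (by simp [Matrix.IsSymm, hM.eq]) fun x => ?_
  simp only [sub_mulVec, smul_mulVec, one_mulVec, dotProduct_sub, dotProduct_smul, smul_eq_mul]
  linarith [h x]

theorem posSemidef_smul_one_sub {k : ℕ} {M : Matrix (Fin k) (Fin k) ℝ} (hM : M.IsSymm) {c : ℝ}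
    (h : ∀ y, y ⬝ᵥ (M *ᵥ y) ≤ c * (y ⬝ᵥ y)) : (c • 1 - M).PosSemidef := by
  refine posSemidef_of_isSymm (by simp [Matrix.IsSymm, hM.eq]) fun x => ?_
  simp only [sub_mulVec, smul_mulVec, one_mulVec, dotProduct_sub, dotProduct_smul, smul_eq_mul]
  linarith [h x]

theorem mul_trace_le_trace_mul {k : ℕ} {X M : Matrix (Fin k) (Fin k) ℝ} (hX : X.PosSemidef)
    (hM : M.IsSymm) {c : ℝ} (h : ∀ y, c * (y ⬝ᵥ y) ≤ y ⬝ᵥ (M *ᵥ y)) :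
    c * X.trace ≤ (X * M).trace := by
  have := trace_mul_nonneg hX (posSemidef_sub_smul_one hM h)
  simp only [mul_sub, trace_sub, mul_smul_comm, mul_one, trace_smul, smul_eq_mul] at this
  linarith

theorem trace_mul_le_mul_trace {k : ℕ} {X M : Matrix (Fin k) (Fin k) ℝ} (hX : X.PosSemidef)
    (hM : M.IsSymm) {c : ℝ} (h : ∀ y, y ⬝ᵥ (M *ᵥ y) ≤ c * (y ⬝ᵥ y)) :
    (X * M).trace ≤ c * X.trace := by
  have := trace_mul_nonneg hX (posSemidef_smul_one_sub hM h)
  simp only [mul_sub, trace_sub, mul_smul_comm, mul_one, trace_smul, smul_eq_mul] at this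
  linarith

theorem dot_mulVec_le_trace {k : ℕ} {P : Matrix (Fin k) (Fin k) ℝ} (hP : P.PosSemidef)
    (x : Fin k → ℝ) : x ⬝ᵥ (P *ᵥ x) ≤ P.trace * (x ⬝ᵥ x) := by
  -- The rank one matrix x xᵀ has largest eigenvalue x ⬝ x, and its trace against P is the form at
  -- x.
  have := trace_mul_le_mul_trace (M := vecMulVec x x) hP (by simp [Matrix.IsSymm, transpose_vecMulVec])
    (c := x ⬝ᵥ x) fun y => by
      rw [vecMulVec_mulVec]
      simp only [dotProduct_smul, MulOpposite.smul_eq_mul_unop, MulOpposite.unop_op]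
      have := dot_sq_le x y
      rw [dotProduct_comm y x]
      nlinarith
  rw [dot_vecMulVec_mul] at this
  linarith

theorem frobNorm_nonneg {ι κ : Type*} [Fintype ι] [Fintype κ] (M : Matrix ι κ ℝ) :
    0 ≤ frobNorm M := Real.sqrt_nonneg _

/-- The two lower blocks act together on the stacked vector (v, u): Cauchy–Schwarz in each lower
row, the upper rows being discarded. -/
theorem toBlocks_mulVec_dot_self_le {n d : ℕ} (M : Matrix (Fin n ⊕ Fin d) (Fin n ⊕ Fin d) ℝ)
    (v : Fin n → ℝ) (u : Fin d → ℝ) :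
    (M.toBlocks₂₁ *ᵥ v + M.toBlocks₂₂ *ᵥ u) ⬝ᵥ (M.toBlocks₂₁ *ᵥ v + M.toBlocks₂₂ *ᵥ u) ≤
      frobNorm M ^ 2 * (v ⬝ᵥ v + u ⬝ᵥ u) := by
  have key : ∀ i : Fin d, (M.toBlocks₂₁ *ᵥ v + M.toBlocks₂₂ *ᵥ u) i =
      ∑ j, M (Sum.inr i) j * Sum.elim v u j := fun i => by
    simp [mulVec, dotProduct, toBlocks₂₁, toBlocks₂₂]
  have hz : v ⬝ᵥ v + u ⬝ᵥ u = ∑ j, Sum.elim v u j ^ 2 := by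
    simp [dotProduct, sq]
  have hf : frobNorm M ^ 2 = ∑ i, ∑ j, M i j ^ 2 :=
    Real.sq_sqrt (Finset.sum_nonneg fun i _ => Finset.sum_nonneg fun j _ => sq_nonneg _)
  rw [hf, hz, Fintype.sum_sum_type, add_mul]
  refine le_add_of_nonneg_of_le (mul_nonneg (Finset.sum_nonneg fun i _ => Finset.sum_nonneg
    fun j _ => sq_nonneg _) (Finset.sum_nonneg fun j _ => sq_nonneg _)) ?_
  rw [dotProduct, Finset.sum_mul]
  refine Finset.sum_le_sum fun i _ => ?_
  rw [key, ← sq]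
  exact Finset.sum_mul_sq_le_sq_mul_sq _ _ _

end LinearAlgebra

/-! ### Stability, Lyapunov inequalities and Lyapunov series. -/

section Lyapunov

/-- Split a complex eigenvector as a + ib and add the inequality at a and at b. By symmetry of P the
cross terms cancel, leaving |k|² q < q for the eigenvalue k and q = aᵀPa + bᵀPb ≥ 0. -/
theorem spectralRadius_lt_one_of_lyapunov {n : ℕ} {A P : Matrix (Fin n) (Fin n) ℝ}
    (hP : P.PosSemidef) {c : ℝ} (hc : 0 < c) (h : (P - Aᵀ * P * A - c • 1).PosSemidef) :
    spectralRadius ℂ (A.map (algebraMap ℝ ℂ)) < 1 := by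
  let _ := Matrix.linftyOpNormedRing (n := Fin n) (α := ℂ)
  let _ := Matrix.linftyOpNormedAlgebra (n := Fin n) (R := ℂ) (α := ℂ)
  rcases isEmpty_or_nonempty (Fin n) with hn | hn
  · simp [spectralRadius]
  refine spectrum.spectralRadius_lt_of_forall_lt (r := 1) _ fun k hk => ?_
  rw [← Matrix.spectrum_toLin', ← Module.End.hasEigenvalue_iff_mem_spectrum] at hk
  obtain ⟨v, hv⟩ := hk.exists_hasEigenvector
  have hv1 : A.map (algebraMap ℝ ℂ) *ᵥ v = k • v := by simpa using hv.apply_eq_smul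
  set a : Fin n → ℝ := fun i => (v i).re with ha
  set b : Fin n → ℝ := fun i => (v i).im with hb
  have hAa : A *ᵥ a = k.re • a - k.im • b := by
    ext i
    have := congrArg Complex.re (congrFun hv1 i)
    simpa [mulVec, dotProduct, ha, hb] using this
  have hAb : A *ᵥ b = k.re • b + k.im • a := by
    ext i
    have := congrArg Complex.im (congrFun hv1 i)
    simpa [mulVec, dotProduct, ha, hb, add_comm] using this
  have h1 := h.dot_nonneg a
  have h2 := h.dot_nonneg b
  simp only [sub_mulVec, dotProduct_sub, dot_conj_mulVec, smul_mulVec, one_mulVec, dotProduct_smul,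
    smul_eq_mul, hAa, hAb, mulVec_sub, mulVec_add, mulVec_smul, sub_dotProduct, add_dotProduct,
    dotProduct_add, smul_dotProduct] at h1 h2
  have hqa := hP.dot_nonneg a
  have hqb := hP.dot_nonneg b
  have hv0 : 0 < a ⬝ᵥ a + b ⬝ᵥ b := by
    rcases (add_nonneg (dot_self_nonneg a) (dot_self_nonneg b)).lt_or_eq with h | h
    · exact h
    · exfalso
      have ea := dotProduct_self_eq_zero.mp
        ((add_eq_zero_iff_of_nonneg (dot_self_nonneg a) (dot_self_nonneg b)).mp h.symm).1
      have eb := dotProduct_self_eq_zero.mp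
        ((add_eq_zero_iff_of_nonneg (dot_self_nonneg a) (dot_self_nonneg b)).mp h.symm).2
      exact hv.2 (funext fun i => Complex.ext (congrFun ea i) (congrFun eb i))
  have hcv := mul_pos hc hv0
  have key : (k.re ^ 2 + k.im ^ 2) * (a ⬝ᵥ (P *ᵥ a) + b ⬝ᵥ (P *ᵥ b)) <
      a ⬝ᵥ (P *ᵥ a) + b ⬝ᵥ (P *ᵥ b) := by
    have e := hP.isSymm.dot_comm a b
    rw [e] at h1 h2
    nlinarith
  have hk2 : ‖k‖ ^ 2 < 1 := by
    rw [Complex.sq_norm, Complex.normSq_apply]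
    by_contra! hcon
    nlinarith
  have : ‖k‖ < 1 := by nlinarith [norm_nonneg k]
  exact_mod_cast this

open scoped Matrix.Norms.L2Operator in
-- Gelfand's formula gives ‖Aᵗ‖ ≤ rᵗ eventually, for some r < 1.
theorem summable_norm_pow_sq {n : ℕ} {A : Matrix (Fin n) (Fin n) ℂ}
    (h : spectralRadius ℂ A < 1) : Summable fun t : ℕ => ‖A ^ t‖ ^ 2 := by
  obtain ⟨r, hr1, hr2⟩ := ENNReal.lt_iff_exists_nnreal_btwn.mp h
  have hr3 : r < 1 := by exact_mod_cast hr2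
  have hev := (spectrum.pow_nnnorm_pow_one_div_tendsto_nhds_spectralRadius A).eventually_lt_const hr1
  have hg : Summable fun t : ℕ => ((r : ℝ) ^ 2) ^ t :=
    summable_geometric_of_lt_one (by positivity) (pow_lt_one₀ r.2 hr3 two_ne_zero)
  refine Summable.of_norm_bounded_eventually hg ?_
  rw [Nat.cofinite_eq_atTop]
  filter_upwards [hev, Filter.eventually_gt_atTop 0] with t ht ht0
  rw [Real.norm_of_nonneg (by positivity), ← pow_mul, mul_comm 2 t, pow_mul]
  refine pow_le_pow_left₀ (norm_nonneg _) ?_ 2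
  have h1 : (‖A ^ t‖₊ : ℝ≥0∞) ≤ (r : ℝ≥0∞) ^ t := by
    have := ENNReal.rpow_le_rpow ht.le (z := t) (by positivity)
    rwa [← ENNReal.rpow_mul, one_div, inv_mul_cancel₀ (by positivity), ENNReal.rpow_one,
      ENNReal.rpow_natCast] at this
  exact_mod_cast h1

theorem Summable.of_map_ofReal {n : ℕ} {f : ℕ → Matrix (Fin n) (Fin n) ℝ}
    (h : Summable fun t => (f t).map (algebraMap ℝ ℂ)) : Summable f := by
  have := h.map (Complex.reAddGroupHom.mapMatrix (m := Fin n) (n := Fin n))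
    (continuous_id.matrix_map Complex.continuous_re)
  convert this using 1
  ext t i j
  simp

open scoped Matrix.Norms.L2Operator in
theorem summable_conj_pow {n : ℕ} {A : Matrix (Fin n) (Fin n) ℝ}
    (h : spectralRadius ℂ (A.map (algebraMap ℝ ℂ)) < 1) (W : Matrix (Fin n) (Fin n) ℝ)
    {γ : ℝ} (h0 : 0 ≤ γ) (h1 : γ ≤ 1) :
    (Summable fun t : ℕ => γ ^ t • ((A ^ t)ᵀ * W * A ^ t)) ∧
      Summable fun t : ℕ => γ ^ t • (A ^ t * W * (A ^ t)ᵀ) := by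
  have hs := (summable_norm_pow_sq h).mul_right ‖W.map (algebraMap ℝ ℂ)‖
  have hpow : ∀ t, (A ^ t).map (algebraMap ℝ ℂ) = A.map (algebraMap ℝ ℂ) ^ t := fun t =>
    map_pow (algebraMap ℝ ℂ).mapMatrix A t
  have htr : ∀ t, (A ^ t)ᵀ.map (algebraMap ℝ ℂ) = (A.map (algebraMap ℝ ℂ) ^ t)ᴴ := fun t => by
    rw [← hpow]
    ext i j
    simp [-transpose_pow]
  have hm : ∀ (t : ℕ) (X : Matrix (Fin n) (Fin n) ℝ),
      (γ ^ t • X).map (algebraMap ℝ ℂ) = (γ : ℂ) ^ t • X.map (algebraMap ℝ ℂ) := fun t X => by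
    ext i j
    simp
  have hγ : ∀ t : ℕ, ‖(γ : ℂ) ^ t‖ ≤ 1 := fun t => by
    rw [norm_pow, Complex.norm_real, Real.norm_of_nonneg h0]
    exact pow_le_one₀ h0 h1
  constructor <;>
  · refine .of_map_ofReal (.of_norm_bounded hs fun t => ?_)
    rw [hm, Matrix.map_mul, Matrix.map_mul, htr, hpow, norm_smul]
    refine (mul_le_of_le_one_left (norm_nonneg _) (hγ t)).trans ?_
    refine (norm_mul_le _ _).trans ((mul_le_mul_of_nonneg_right (norm_mul_le _ _)
      (norm_nonneg _)).trans (le_of_eq ?_))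
    rw [l2_opNorm_conjTranspose]
    ring

theorem HasSum.posSemidef {n : ℕ} {f : ℕ → Matrix (Fin n) (Fin n) ℝ}
    {P : Matrix (Fin n) (Fin n) ℝ} (h : HasSum f P) (hf : ∀ t, (f t).PosSemidef) :
    P.PosSemidef := by
  refine posSemidef_of_isSymm (h.matrix_transpose.unique ?_) fun x => ?_
  · simpa only [(hf _).isSymm.eq] using h
  · have := h.map (AddMonoidHom.mk' (fun M : Matrix (Fin n) (Fin n) ℝ => x ⬝ᵥ (M *ᵥ x))
      fun M N => by rw [add_mulVec, dotProduct_add]) (by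
        change Continuous fun M : Matrix (Fin n) (Fin n) ℝ => x ⬝ᵥ (M *ᵥ x)
        fun_prop)
    exact this.nonneg fun t => (hf t).dot_nonneg x

theorem HasSum.trace_mul {n : ℕ} {f : ℕ → Matrix (Fin n) (Fin n) ℝ}
    {P : Matrix (Fin n) (Fin n) ℝ} (h : HasSum f P) (W : Matrix (Fin n) (Fin n) ℝ) :
    HasSum (fun t => (W * f t).trace) (W * P).trace := by
  exact (h.mul_left W).map (traceAddMonoidHom (Fin n) ℝ) (continuous_id.matrix_trace)

theorem HasSum.quadForm {n : ℕ} {f : ℕ → Matrix (Fin n) (Fin n) ℝ}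
    {P : Matrix (Fin n) (Fin n) ℝ} (h : HasSum f P) (y : Fin n → ℝ) :
    HasSum (fun t => y ⬝ᵥ (f t *ᵥ y)) (y ⬝ᵥ (P *ᵥ y)) := by
  have := h.mul_right (vecMulVec y y) |>.map (traceAddMonoidHom (Fin n) ℝ)
    (continuous_id.matrix_trace)
  simpa [Function.comp_def, traceAddMonoidHom, dot_vecMulVec_mul] using this

theorem exists_lyapunov {n : ℕ} {A : Matrix (Fin n) (Fin n) ℝ}
    (h : spectralRadius ℂ (A.map (algebraMap ℝ ℂ)) < 1) {W : Matrix (Fin n) (Fin n) ℝ}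
    (hW : W.PosSemidef) {γ : ℝ} (h0 : 0 ≤ γ) (h1 : γ ≤ 1) :
    ∃ P : Matrix (Fin n) (Fin n) ℝ, P.PosSemidef ∧ P = W + γ • (Aᵀ * P * A) ∧
      HasSum (fun t : ℕ => γ ^ t • ((A ^ t)ᵀ * W * A ^ t)) P := by
  have hs := (summable_conj_pow h W h0 h1).1
  refine ⟨_, hs.hasSum.posSemidef fun t => (hW.conj _).smul (pow_nonneg h0 t), ?_, hs.hasSum⟩
  conv_lhs => rw [hs.tsum_eq_zero_add]
  have := ((hs.hasSum.mul_left Aᵀ).mul_right A).const_smul γ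
  rw [← this.tsum_eq]
  simp only [pow_zero, transpose_one, one_mul, mul_one, one_smul]
  congr 1
  refine tsum_congr fun t => ?_
  simp only [pow_succ, transpose_mul, mul_smul_comm, smul_mul_assoc, smul_smul, mul_assoc, mul_comm γ]

theorem exists_lyapunov_dual {n : ℕ} {A : Matrix (Fin n) (Fin n) ℝ}
    (h : spectralRadius ℂ (A.map (algebraMap ℝ ℂ)) < 1) {W : Matrix (Fin n) (Fin n) ℝ}
    (hW : W.PosSemidef) :
    ∃ P : Matrix (Fin n) (Fin n) ℝ, P.PosSemidef ∧ P = A * P * Aᵀ + W := by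
  have hs := (summable_conj_pow h W zero_le_one le_rfl).2
  refine ⟨_, hs.hasSum.posSemidef fun t => (hW.conj' _).smul (pow_nonneg zero_le_one t), ?_⟩
  conv_lhs => rw [hs.tsum_eq_zero_add, add_comm]
  have := ((hs.hasSum.mul_left A).mul_right Aᵀ)
  rw [← this.tsum_eq]
  simp only [pow_zero, transpose_one, one_mul, mul_one, one_smul]
  congr 1
  refine tsum_congr fun t => ?_
  simp only [pow_succ', transpose_mul, one_pow, one_smul, mul_one, mul_assoc]

end Lyapunov

noncomputable section

/-! ### Second moment matrices. Independence enters the cost computations only through vanishing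
correlations. -/

section CrossMoment

variable {Ω : Type*} [MeasurableSpace Ω] {μ : Measure Ω} {a b c : ℕ}

/-- The vector valued function `f` has square integrable components. -/
def L2Vec (μ : Measure Ω) (f : Ω → Fin a → ℝ) : Prop := ∀ i, MemLp (fun w => f w i) 2 μ

/-- The matrix `E[f gᵀ]`. -/
def crossMoment (μ : Measure Ω) (f : Ω → Fin a → ℝ) (g : Ω → Fin b → ℝ) :
    Matrix (Fin a) (Fin b) ℝ :=
  Matrix.of fun i j => ∫ w, f w i * g w j ∂μ

theorem L2Vec.integrable_mul {f : Ω → Fin a → ℝ} {g : Ω → Fin b → ℝ} (hf : L2Vec μ f)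
    (hg : L2Vec μ g) (i : Fin a) (j : Fin b) : Integrable (fun w => f w i * g w j) μ :=
  MemLp.integrable_mul (hf i) (hg j)

theorem L2Vec.add {f g : Ω → Fin a → ℝ} (hf : L2Vec μ f) (hg : L2Vec μ g) :
    L2Vec μ (fun w => f w + g w) := fun i => (hf i).add (hg i)

theorem L2Vec.mulVec {f : Ω → Fin a → ℝ} (hf : L2Vec μ f) (M : Matrix (Fin b) (Fin a) ℝ) :
    L2Vec μ (fun w => M *ᵥ f w) := fun i => by
  simp only [Matrix.mulVec, dotProduct]
  exact memLp_finsetSum _ fun j _ => (hf j).const_mul _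

theorem L2Vec.const [IsFiniteMeasure μ] (v : Fin a → ℝ) : L2Vec μ (fun _ => v) :=
  fun i => memLp_const (v i)

theorem crossMoment_transpose (f : Ω → Fin a → ℝ) (g : Ω → Fin b → ℝ) :
    (crossMoment μ f g)ᵀ = crossMoment μ g f := by
  ext i j
  simp [crossMoment, mul_comm]

theorem crossMoment_add_left {f g : Ω → Fin a → ℝ} {h : Ω → Fin b → ℝ} (hf : L2Vec μ f)
    (hg : L2Vec μ g) (hh : L2Vec μ h) :
    crossMoment μ (fun w => f w + g w) h = crossMoment μ f h + crossMoment μ g h := by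
  ext i j
  simp only [crossMoment, of_apply, Matrix.add_apply, Pi.add_apply, add_mul]
  exact integral_add (hf.integrable_mul hh i j) (hg.integrable_mul hh i j)

theorem crossMoment_mulVec_left {f : Ω → Fin a → ℝ} {h : Ω → Fin b → ℝ} (hf : L2Vec μ f)
    (hh : L2Vec μ h) (M : Matrix (Fin c) (Fin a) ℝ) :
    crossMoment μ (fun w => M *ᵥ f w) h = M * crossMoment μ f h := by
  ext i j
  simp only [crossMoment, of_apply, Matrix.mul_apply, Matrix.mulVec, dotProduct, Finset.sum_mul,
    mul_assoc]
  rw [integral_finsetSum _ fun k _ => (hf.integrable_mul hh k j).const_mul _]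
  simp only [integral_const_mul]

theorem crossMoment_add_right {f g : Ω → Fin a → ℝ} {h : Ω → Fin b → ℝ} (hf : L2Vec μ f)
    (hg : L2Vec μ g) (hh : L2Vec μ h) :
    crossMoment μ h (fun w => f w + g w) = crossMoment μ h f + crossMoment μ h g := by
  rw [← crossMoment_transpose, crossMoment_add_left hf hg hh, transpose_add,
    crossMoment_transpose, crossMoment_transpose]

theorem crossMoment_mulVec_right {f : Ω → Fin a → ℝ} {h : Ω → Fin b → ℝ} (hf : L2Vec μ f)
    (hh : L2Vec μ h) (M : Matrix (Fin c) (Fin a) ℝ) :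
    crossMoment μ h (fun w => M *ᵥ f w) = crossMoment μ h f * Mᵀ := by
  rw [← crossMoment_transpose, crossMoment_mulVec_left hf hh, transpose_mul, crossMoment_transpose]

/-- The second moment matrix of a sum of uncorrelated vectors. -/
theorem crossMoment_mulVec_add_self {f : Ω → Fin a → ℝ} {g : Ω → Fin b → ℝ} (hf : L2Vec μ f)
    (hg : L2Vec μ g) (h : crossMoment μ f g = 0) (M : Matrix (Fin b) (Fin a) ℝ) :
    crossMoment μ (fun w => M *ᵥ f w + g w) (fun w => M *ᵥ f w + g w) =
      M * crossMoment μ f f * Mᵀ + crossMoment μ g g := by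
  have h' : crossMoment μ g f = 0 := by rw [← crossMoment_transpose, h, transpose_zero]
  rw [crossMoment_add_left (hf.mulVec M) hg ((hf.mulVec M).add hg),
    crossMoment_add_right (hf.mulVec M) hg (hf.mulVec M),
    crossMoment_add_right (hf.mulVec M) hg hg, crossMoment_mulVec_left hf (hf.mulVec M),
    crossMoment_mulVec_right hf hf, crossMoment_mulVec_left hf hg, crossMoment_mulVec_right hf hg,
    h, h']
  simp [Matrix.mul_assoc]

theorem L2Vec.integrable_quad {f : Ω → Fin a → ℝ} (hf : L2Vec μ f)
    (W : Matrix (Fin a) (Fin a) ℝ) : Integrable (fun w => f w ⬝ᵥ (W *ᵥ f w)) μ := by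
  simp only [dotProduct]
  exact integrable_finsetSum _ fun i _ => hf.integrable_mul (hf.mulVec W) i i

theorem integral_quad {f : Ω → Fin a → ℝ} (hf : L2Vec μ f) (W : Matrix (Fin a) (Fin a) ℝ) :
    ∫ w, f w ⬝ᵥ (W *ᵥ f w) ∂μ = (W * crossMoment μ f f).trace := by
  rw [← crossMoment_mulVec_left hf hf]
  simp only [dotProduct, trace, diag, crossMoment, of_apply]
  rw [integral_finsetSum _ fun i _ => hf.integrable_mul (hf.mulVec W) i i]
  simp only [mul_comm]

theorem crossMoment_self_posSemidef {f : Ω → Fin a → ℝ} (hf : L2Vec μ f) :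
    (crossMoment μ f f).PosSemidef := by
  refine posSemidef_of_isSymm (crossMoment_transpose f f) fun x => ?_
  rw [← dot_vecMulVec_mul, trace_mul_comm, ← integral_quad hf]
  refine integral_nonneg fun w => ?_
  rw [vecMulVec_mulVec]
  simp only [dotProduct_smul, MulOpposite.smul_eq_mul_unop, MulOpposite.unop_op]
  rw [dotProduct_comm]
  exact mul_self_nonneg _

theorem crossMoment_eq_zero_of_indepFun {f : Ω → EuclideanSpace ℝ (Fin a)}
    {g : Ω → EuclideanSpace ℝ (Fin b)} (h : IndepFun f g μ)
    (hf : L2Vec μ fun w => (f w).ofLp) (hg : L2Vec μ fun w => (g w).ofLp)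
    (h0 : ∀ i, ∫ w, (f w).ofLp i ∂μ = 0) :
    crossMoment μ (fun w => (f w).ofLp) (fun w => (g w).ofLp) = 0 := by
  ext i j
  have hij : IndepFun (fun w => (f w).ofLp i) (fun w => (g w).ofLp j) μ :=
    h.comp (φ := fun x : EuclideanSpace ℝ (Fin a) => x.ofLp i)
      (ψ := fun x : EuclideanSpace ℝ (Fin b) => x.ofLp j) (by fun_prop) (by fun_prop)
  simp only [crossMoment, of_apply, Matrix.zero_apply]
  rw [hij.integral_fun_mul_eq_mul_integral (hf i).1 (hg j).1, h0, zero_mul]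

end CrossMoment

/-! ### Moments of centered Gaussian vectors. -/

section Gaussian

variable {Ω : Type*} [MeasurableSpace Ω] {μ : Measure Ω} {a : ℕ}

theorem L2Vec_of_hasLaw {X : Ω → EuclideanSpace ℝ (Fin a)} {C : Matrix (Fin a) (Fin a) ℝ}
    (h : HasLaw X (multivariateGaussian 0 C) μ) : L2Vec μ fun w => (X w).ofLp := fun i => by
  have h1 : MemLp (fun x : EuclideanSpace ℝ (Fin a) => x.ofLp i) 2 (multivariateGaussian 0 C) := by
    have := (IsGaussian.memLp_id (multivariateGaussian (0 : EuclideanSpace ℝ (Fin a)) C) 2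
      (by norm_num)).norm
    refine this.mono' (by fun_prop) (ae_of_all _ fun x => ?_)
    exact PiLp.norm_apply_le x i
  rw [← h.map_eq] at h1
  exact h1.comp_of_map h.aemeasurable

theorem integral_coord_of_hasLaw {X : Ω → EuclideanSpace ℝ (Fin a)}
    {C : Matrix (Fin a) (Fin a) ℝ} (h : HasLaw X (multivariateGaussian 0 C) μ) (i : Fin a) :
    ∫ w, (X w).ofLp i ∂μ = 0 := by
  have hp := h.isProbabilityMeasure
  rw [← eval_integral_piLp (fun j => (L2Vec_of_hasLaw h j).integrable (by norm_num)) i]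
  have := h.integral_comp (f := id) (by fun_prop)
  simp only [id, integral_id_multivariateGaussian, Function.comp_def] at this
  rw [this, PiLp.zero_apply]

/-- Shows that the second moments do not depend on time, without evaluating the Gaussian covariance.
-/
theorem crossMoment_of_hasLaw {X : Ω → EuclideanSpace ℝ (Fin a)}
    {C : Matrix (Fin a) (Fin a) ℝ} (h : HasLaw X (multivariateGaussian 0 C) μ) :
    crossMoment μ (fun w => (X w).ofLp) (fun w => (X w).ofLp) =
      crossMoment (multivariateGaussian 0 C) (fun x => x.ofLp) (fun x => x.ofLp) := by
  ext i j
  exact h.integral_comp (f := fun x => x.ofLp i * x.ofLp j) (by fun_prop)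

end Gaussian

/-! ### Correlations of the noise and the closed loop process. -/

namespace LQR

variable {n d : ℕ} {Ω : Type*} [MeasurableSpace Ω] {L : LQR n d Ω}

theorem Standing.l2_ω (hL : L.Standing) (t : ℕ) : L2Vec L.P fun w => (L.ω t w).ofLp :=
  L2Vec_of_hasLaw (hL.law_ω t)

theorem Standing.l2_η (hL : L.Standing) (t : ℕ) : L2Vec L.P fun w => (L.η t w).ofLp :=
  L2Vec_of_hasLaw (hL.law_η t)

theorem Standing.l2_noiseTilde (hL : L.Standing) (t : ℕ) : L2Vec L.P (L.noiseTilde t) :=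
  ((hL.l2_η t).mulVec L.B).add (hL.l2_ω t)

theorem Standing.crossMoment_ω_ω (hL : L.Standing) {s t : ℕ} (h : s ≠ t) :
    crossMoment L.P (fun w => (L.ω s w).ofLp) (fun w => (L.ω t w).ofLp) = 0 :=
  crossMoment_eq_zero_of_indepFun ((hL.indep_time.indepFun h).comp measurable_fst measurable_fst)
    (hL.l2_ω s) (hL.l2_ω t) (integral_coord_of_hasLaw (hL.law_ω s))

theorem Standing.crossMoment_η_η (hL : L.Standing) {s t : ℕ} (h : s ≠ t) :
    crossMoment L.P (fun w => (L.η s w).ofLp) (fun w => (L.η t w).ofLp) = 0 :=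
  crossMoment_eq_zero_of_indepFun ((hL.indep_time.indepFun h).comp measurable_snd measurable_snd)
    (hL.l2_η s) (hL.l2_η t) (integral_coord_of_hasLaw (hL.law_η s))

theorem Standing.crossMoment_ω_η (hL : L.Standing) (s t : ℕ) :
    crossMoment L.P (fun w => (L.ω s w).ofLp) (fun w => (L.η t w).ofLp) = 0 := by
  refine crossMoment_eq_zero_of_indepFun ?_
    (hL.l2_ω s) (hL.l2_η t) (integral_coord_of_hasLaw (hL.law_ω s))
  rcases eq_or_ne s t with rfl | h
  · exact hL.indep_noise s
  · exact (hL.indep_time.indepFun h).comp measurable_fst measurable_snd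

theorem Standing.crossMoment_η_ω (hL : L.Standing) (s t : ℕ) :
    crossMoment L.P (fun w => (L.η s w).ofLp) (fun w => (L.ω t w).ofLp) = 0 := by
  rw [← crossMoment_transpose, hL.crossMoment_ω_η, transpose_zero]

theorem Standing.crossMoment_ω_noiseTilde (hL : L.Standing) {s t : ℕ} (h : s ≠ t) :
    crossMoment L.P (fun w => (L.ω s w).ofLp) (L.noiseTilde t) = 0 := by
  change crossMoment L.P _ (fun w => L.B *ᵥ (L.η t w).ofLp + (L.ω t w).ofLp) = 0
  rw [crossMoment_add_right ((hL.l2_η t).mulVec L.B) (hL.l2_ω t) (hL.l2_ω s),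
    crossMoment_mulVec_right (hL.l2_η t) (hL.l2_ω s), hL.crossMoment_ω_η, hL.crossMoment_ω_ω h,
    Matrix.zero_mul, zero_add]

theorem Standing.crossMoment_η_noiseTilde (hL : L.Standing) {s t : ℕ} (h : s ≠ t) :
    crossMoment L.P (fun w => (L.η s w).ofLp) (L.noiseTilde t) = 0 := by
  change crossMoment L.P _ (fun w => L.B *ᵥ (L.η t w).ofLp + (L.ω t w).ofLp) = 0
  rw [crossMoment_add_right ((hL.l2_η t).mulVec L.B) (hL.l2_ω t) (hL.l2_η s),
    crossMoment_mulVec_right (hL.l2_η t) (hL.l2_η s), hL.crossMoment_η_ω, hL.crossMoment_η_η h,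
    Matrix.zero_mul, zero_add]

theorem Standing.crossMoment_noiseTilde_noiseTilde (hL : L.Standing) {s t : ℕ} (h : s ≠ t) :
    crossMoment L.P (L.noiseTilde s) (L.noiseTilde t) = 0 := by
  change crossMoment L.P (fun w => L.B *ᵥ (L.η s w).ofLp + (L.ω s w).ofLp) _ = 0
  rw [crossMoment_add_left ((hL.l2_η s).mulVec L.B) (hL.l2_ω s) (hL.l2_noiseTilde t),
    crossMoment_mulVec_left (hL.l2_η s) (hL.l2_noiseTilde t), hL.crossMoment_η_noiseTilde h,
    hL.crossMoment_ω_noiseTilde h, Matrix.mul_zero, zero_add]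

theorem Standing.crossMoment_noiseTilde_η (hL : L.Standing) {s t : ℕ} (h : s ≠ t) :
    crossMoment L.P (L.noiseTilde s) (fun w => (L.η t w).ofLp) = 0 := by
  rw [← crossMoment_transpose, hL.crossMoment_η_noiseTilde h.symm, transpose_zero]

theorem Standing.crossMoment_noiseTilde_self (hL : L.Standing) (t : ℕ) :
    crossMoment L.P (L.noiseTilde t) (L.noiseTilde t) = L.DTilde := by
  have key : ∀ t, crossMoment L.P (L.noiseTilde t) (L.noiseTilde t) = _ := fun t =>
    crossMoment_mulVec_add_self (hL.l2_η t) (hL.l2_ω t) (hL.crossMoment_η_ω t t) L.B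
  have h0 : L.DTilde = crossMoment L.P (L.noiseTilde 0) (L.noiseTilde 0) := rfl
  rw [h0, key, key, crossMoment_of_hasLaw (hL.law_ω t), crossMoment_of_hasLaw (hL.law_ω 0),
    crossMoment_of_hasLaw (hL.law_η t), crossMoment_of_hasLaw (hL.law_η 0)]

variable (L) in
/-- The expected cost `E[ηᵀ R η]` of the exploration noise. -/
def noiseCost : ℝ :=
  (L.R * crossMoment L.P (fun w => (L.η 0 w).ofLp) (fun w => (L.η 0 w).ofLp)).trace

variable (L) in
/-- The closed loop matrix `A + B K`. -/
def loop (K : Matrix (Fin d) (Fin n) ℝ) : Matrix (Fin n) (Fin n) ℝ := L.A + L.B * K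

variable (L) in
/-- The stage cost matrix `S + Kᵀ R K` of the gain `K`. -/
def gainCost (K : Matrix (Fin d) (Fin n) ℝ) : Matrix (Fin n) (Fin n) ℝ := L.S + Kᵀ * L.R * K

theorem Standing.noiseCost_nonneg (hL : L.Standing) : 0 ≤ L.noiseCost :=
  trace_mul_nonneg hL.posDef_R.posSemidef (crossMoment_self_posSemidef (hL.l2_η 0))

theorem Standing.gainCost_posSemidef (hL : L.Standing) (K : Matrix (Fin d) (Fin n) ℝ) :
    (L.gainCost K).PosSemidef :=
  hL.posDef_S.posSemidef.add (hL.posDef_R.posSemidef.conj K)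

/-- The closed loop process `Yₜ₊₁ = (A + B K) Yₜ + ω̃ₜ₊ₖ`, with initial state uncorrelated with the
noise. -/
structure IsClosedLoop (L : LQR n d Ω) (K : Matrix (Fin d) (Fin n) ℝ) (k : ℕ)
    (Y : ℕ → Ω → Fin n → ℝ) : Prop where
  l2_zero : L2Vec L.P (Y 0)
  zero_noise : ∀ r, crossMoment L.P (Y 0) (L.noiseTilde (r + k)) = 0
  zero_η : ∀ r, crossMoment L.P (Y 0) (fun w => (L.η (r + k) w).ofLp) = 0
  step : ∀ t, Y (t + 1) = fun w => L.loop K *ᵥ Y t w + L.noiseTilde (t + k) w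

/-- The sequence `Mₜ₊₁ = A Mₜ Aᵀ + D`. -/
def momentSeq (A D M₀ : Matrix (Fin n) (Fin n) ℝ) : ℕ → Matrix (Fin n) (Fin n) ℝ
  | 0 => M₀
  | t + 1 => A * momentSeq A D M₀ t * Aᵀ + D

/-- The state at time t involves only the initial state and earlier noise, so it is uncorrelated
with the noise from time t on. -/
theorem IsClosedLoop.uncorrelated (hL : L.Standing) {K : Matrix (Fin d) (Fin n) ℝ} {k : ℕ}
    {Y : ℕ → Ω → Fin n → ℝ} (hY : L.IsClosedLoop K k Y) (t : ℕ) :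
    L2Vec L.P (Y t) ∧ (∀ r, t ≤ r → crossMoment L.P (Y t) (L.noiseTilde (r + k)) = 0) ∧
      ∀ r, t ≤ r → crossMoment L.P (Y t) (fun w => (L.η (r + k) w).ofLp) = 0 := by
  induction t with
  | zero => exact ⟨hY.l2_zero, fun r _ => hY.zero_noise r, fun r _ => hY.zero_η r⟩
  | succ t ih =>
    obtain ⟨h1, h2, h3⟩ := ih
    rw [hY.step]
    have hn := hL.l2_noiseTilde (t + k)
    refine ⟨(h1.mulVec _).add hn, fun r hr => ?_, fun r hr => ?_⟩
    · rw [crossMoment_add_left (h1.mulVec _) hn (hL.l2_noiseTilde _),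
        crossMoment_mulVec_left h1 (hL.l2_noiseTilde _), h2 r (by lia),
        hL.crossMoment_noiseTilde_noiseTilde (by lia), Matrix.mul_zero, zero_add]
    · rw [crossMoment_add_left (h1.mulVec _) hn (hL.l2_η _),
        crossMoment_mulVec_left h1 (hL.l2_η _), h3 r (by lia),
        hL.crossMoment_noiseTilde_η (by lia), Matrix.mul_zero, zero_add]

theorem IsClosedLoop.crossMoment_self (hL : L.Standing) {K : Matrix (Fin d) (Fin n) ℝ} {k : ℕ}
    {Y : ℕ → Ω → Fin n → ℝ} (hY : L.IsClosedLoop K k Y) (t : ℕ) :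
    crossMoment L.P (Y t) (Y t) =
      momentSeq (L.loop K) L.DTilde (crossMoment L.P (Y 0) (Y 0)) t := by
  induction t with
  | zero => rfl
  | succ t ih =>
    obtain ⟨h1, h2, -⟩ := hY.uncorrelated hL t
    rw [momentSeq, ← ih, hY.step,
      crossMoment_mulVec_add_self h1 (hL.l2_noiseTilde _) (h2 t le_rfl),
      hL.crossMoment_noiseTilde_self]

theorem Standing.stageCost_nonneg (hL : L.Standing) (z : (Fin n → ℝ) × (Fin d → ℝ)) :
    0 ≤ L.stageCost z :=
  add_nonneg (hL.posDef_S.posSemidef.dot_nonneg _) (hL.posDef_R.posSemidef.dot_nonneg _)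

theorem IsClosedLoop.lintegral_stageCost (hL : L.Standing) {K : Matrix (Fin d) (Fin n) ℝ} {k : ℕ}
    {Y : ℕ → Ω → Fin n → ℝ} (hY : L.IsClosedLoop K k Y) (t : ℕ) {c : ℝ} (hc : 0 ≤ c) :
    ∫⁻ w, ENNReal.ofReal (c * L.stageCost (Y t w, K *ᵥ Y t w + (L.η (t + k) w).ofLp)) ∂L.P =
      ENNReal.ofReal (c * ((L.gainCost K * crossMoment L.P (Y t) (Y t)).trace + L.noiseCost)) := by
  obtain ⟨h1, -, h3⟩ := hY.uncorrelated hL t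
  have hu : L2Vec L.P (fun w => K *ᵥ Y t w + (L.η (t + k) w).ofLp) :=
    (h1.mulVec K).add (hL.l2_η _)
  have hi : Integrable
      (fun w => L.stageCost (Y t w, K *ᵥ Y t w + (L.η (t + k) w).ofLp)) L.P :=
    (h1.integrable_quad L.S).add (hu.integrable_quad L.R)
  rw [← ofReal_integral_eq_lintegral_ofReal (hi.const_mul c)
    (ae_of_all _ fun w => mul_nonneg hc (hL.stageCost_nonneg _)), integral_const_mul]
  congr 2
  simp only [stageCost]
  rw [integral_add (h1.integrable_quad L.S) (hu.integrable_quad L.R), integral_quad h1,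
    integral_quad hu, crossMoment_mulVec_add_self h1 (hL.l2_η _) (h3 t le_rfl),
    crossMoment_of_hasLaw (hL.law_η _), gainCost, noiseCost, crossMoment_of_hasLaw (hL.law_η 0),
    mul_add, trace_add, add_mul, trace_add, ← add_assoc]
  congr 2
  rw [← Matrix.mul_assoc, trace_mul_comm, ← Matrix.mul_assoc, ← Matrix.mul_assoc]

end LQR


/-! ### Summation of the costs: moments, the objective and the state-action value. -/

theorem HasSum.congr_terms {α : Type*} [AddCommMonoid α] [TopologicalSpace α] {f g : ℕ → α} {a : α}
    (h : HasSum f a) (e : ∀ t, f t = g t) : HasSum g a := funext e ▸ h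

theorem ENNReal_tsum_ofReal_ne_top {f : ℕ → ℝ} (hf : Summable f) :
    ∑' t, ENNReal.ofReal (f t) ≠ ∞ := by
  have := hf.toNNReal
  exact ENNReal.tsum_coe_ne_top_iff_summable.mpr this

theorem summable_of_tsum_ofReal_ne_top {f : ℕ → ℝ} (h0 : ∀ t, 0 ≤ f t)
    (h : ∑' t, ENNReal.ofReal (f t) ≠ ∞) : Summable f := by
  have := ENNReal.summable_toReal h
  simpa only [ENNReal.toReal_ofReal (h0 _)] using this

theorem toReal_tsum_ofReal {f : ℕ → ℝ} (h0 : ∀ t, 0 ≤ f t) {a : ℝ} (h : HasSum f a) :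
    (∑' t, ENNReal.ofReal (f t)).toReal = a := by
  rw [← ENNReal.ofReal_tsum_of_nonneg h0 h.summable, h.tsum_eq,
    ENNReal.toReal_ofReal (h.nonneg h0)]

theorem Matrix.PosSemidef.abs_apply_le_trace {n : ℕ} {M : Matrix (Fin n) (Fin n) ℝ}
    (hM : M.PosSemidef) (i j : Fin n) : |M i j| ≤ M.trace := by
  have hd : ∀ i, M i i ≤ M.trace := fun i =>
    Finset.single_le_sum (f := fun i => M i i) (fun _ _ => hM.diag_nonneg) (Finset.mem_univ i)
  have h1 := hM.dot_nonneg (Pi.single i 1 + Pi.single j 1)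
  have h2 := hM.dot_nonneg (Pi.single i 1 - Pi.single j 1)
  have hs : M j i = M i j := congrFun (congrFun hM.isSymm i) j
  simp only [mulVec_add, mulVec_sub, add_dotProduct, sub_dotProduct, mulVec_single, dotProduct_add,
    dotProduct_sub, single_dotProduct, MulOpposite.op_one, one_smul, one_mul, col_apply, hs]
    at h1 h2
  rw [abs_le]
  constructor <;> linarith [hd i, hd j]

namespace LQR

variable {n d : ℕ} {Ω : Type*} [MeasurableSpace Ω] {L : LQR n d Ω}

theorem momentSeq_posSemidef {A D M₀ : Matrix (Fin n) (Fin n) ℝ} (hD : D.PosSemidef)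
    (hM : M₀.PosSemidef) (t : ℕ) : (momentSeq A D M₀ t).PosSemidef := by
  induction t with
  | zero => exact hM
  | succ t ih => exact (ih.conj' A).add hD

theorem momentSeq_add (A D M₀ M₁ : Matrix (Fin n) (Fin n) ℝ) (t : ℕ) :
    momentSeq A D (M₀ + M₁) t = A ^ t * M₀ * (A ^ t)ᵀ + momentSeq A D M₁ t := by
  induction t with
  | zero => simp [momentSeq]
  | succ t ih => simp only [momentSeq, ih, mul_add, add_mul, pow_succ', transpose_mul, mul_assoc,
      add_assoc]

/-- The moments stay below the fixed point P = A P Aᵀ + D + M₀, so they are bounded and the discount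
factor makes the series converge. -/
theorem summable_trace_momentSeq {A D M₀ W : Matrix (Fin n) (Fin n) ℝ}
    (hA : spectralRadius ℂ (A.map (algebraMap ℝ ℂ)) < 1) (hD : D.PosSemidef)
    (hM : M₀.PosSemidef) (hW : W.PosSemidef) {γ : ℝ} (h0 : 0 ≤ γ) (h1 : γ < 1) :
    Summable fun t => γ ^ t * (W * momentSeq A D M₀ t).trace := by
  obtain ⟨P, hP, hPe⟩ := exists_lyapunov_dual hA (hD.add hM)
  have hle : ∀ t, (P - momentSeq A D M₀ t).PosSemidef := fun t => by
    induction t with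
    | zero =>
      have : P - momentSeq A D M₀ 0 = A * P * Aᵀ + D := by
        conv_lhs => rw [hPe]
        simp only [momentSeq]
        abel
      rw [this]
      exact (hP.conj' A).add hD
    | succ t ih =>
      have : P - momentSeq A D M₀ (t + 1) = A * (P - momentSeq A D M₀ t) * Aᵀ + M₀ := by
        conv_lhs => rw [hPe]
        simp only [momentSeq, mul_sub, sub_mul]
        abel
      rw [this]
      exact (ih.conj' A).add hM
  refine .of_nonneg_of_le (fun t => mul_nonneg (pow_nonneg h0 t)
    (trace_mul_nonneg hW (momentSeq_posSemidef hD hM t)))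
    (fun t => mul_le_mul_of_nonneg_left (trace_mul_le_trace_mul hW (hle t)) (pow_nonneg h0 t))
    ((summable_geometric_of_lt_one h0 h1).mul_right _)

/-! ### The process started at zero -/

theorem traj_startZero (K : Matrix (Fin d) (Fin n) ℝ) (t : ℕ) (w : Ω) :
    L.traj K (L.startZero K) t w = ((L.traj K (L.startZero K) t w).1,
      K *ᵥ (L.traj K (L.startZero K) t w).1 + (L.η (t + 0) w).ofLp) := by
  cases t <;> simp [traj, startZero]

theorem isClosedLoop_startZero (K : Matrix (Fin d) (Fin n) ℝ) :
    L.IsClosedLoop K 0 fun t w => (L.traj K (L.startZero K) t w).1 where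
  l2_zero i := by simp [traj, startZero]
  zero_noise r := by ext; simp [traj, startZero, crossMoment]
  zero_η r := by ext; simp [traj, startZero, crossMoment]
  step t := by
    funext w
    rw [traj, traj_startZero]
    simp only [loop, noiseTilde, mulVec_add, add_mulVec, mulVec_mulVec, add_assoc, add_zero]

variable (L) in
/-- The second moments of the state for the gain `K` and the initial state `0`. -/
def stateMoment (K : Matrix (Fin d) (Fin n) ℝ) (t : ℕ) : Matrix (Fin n) (Fin n) ℝ :=
  momentSeq (L.loop K) L.DTilde 0 t

theorem Standing.crossMoment_state (hL : L.Standing) (K : Matrix (Fin d) (Fin n) ℝ) (t : ℕ) :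
    crossMoment L.P (fun w => (L.traj K (L.startZero K) t w).1)
      (fun w => (L.traj K (L.startZero K) t w).1) = L.stateMoment K t := by
  rw [(isClosedLoop_startZero K).crossMoment_self hL t, stateMoment]
  congr 1
  ext
  simp [traj, startZero, crossMoment]

theorem Standing.stateMoment_posSemidef (hL : L.Standing) (K : Matrix (Fin d) (Fin n) ℝ) (t : ℕ) :
    (L.stateMoment K t).PosSemidef :=
  momentSeq_posSemidef hL.posDef_DTilde.posSemidef .zero t

theorem Standing.JExt_eq (hL : L.Standing) {γ : ℝ} (h0 : 0 ≤ γ) (K : Matrix (Fin d) (Fin n) ℝ) :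
    L.JExt γ K = ∑' t, ENNReal.ofReal
      (γ ^ t * ((L.gainCost K * L.stateMoment K t).trace + L.noiseCost)) := by
  refine tsum_congr fun t => ?_
  rw [← hL.crossMoment_state, ← (isClosedLoop_startZero K).lintegral_stageCost hL t
    (pow_nonneg h0 t)]
  refine lintegral_congr fun w => ?_
  conv_lhs => rw [traj_startZero]

theorem Standing.JExt_ne_top_of_stable (hL : L.Standing) {γ : ℝ} (h0 : 0 ≤ γ) (h1 : γ < 1)
    {K : Matrix (Fin d) (Fin n) ℝ} (hK : L.Stable K) : L.JExt γ K ≠ ∞ := by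
  rw [hL.JExt_eq h0]
  refine ENNReal_tsum_ofReal_ne_top ?_
  simp only [mul_add]
  exact (summable_trace_momentSeq hK hL.posDef_DTilde.posSemidef .zero
    (hL.gainCost_posSemidef K) h0 h1).add ((summable_geometric_of_lt_one h0 h1).mul_right _)

/-- Every entry of a second moment is at most its trace, and positivity of S bounds the trace by the
stage cost. Only finite cost is needed, so this covers K*, which is not known to be stable. -/
theorem Standing.hasSum_sigmaMat (hL : L.Standing) {γ : ℝ} (h0 : 0 ≤ γ)
    {K : Matrix (Fin d) (Fin n) ℝ} (hJ : L.JExt γ K ≠ ∞) :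
    HasSum (fun t => γ ^ t • L.stateMoment K t) (L.SigmaMat γ K) := by
  rw [hL.JExt_eq h0] at hJ
  have hM := hL.stateMoment_posSemidef K
  have hW : ∀ t, 0 ≤ (L.gainCost K * L.stateMoment K t).trace := fun t =>
    trace_mul_nonneg (hL.gainCost_posSemidef K) (hM t)
  have hs := summable_of_tsum_ofReal_ne_top (fun t => mul_nonneg (pow_nonneg h0 t)
    (add_nonneg (hW t) hL.noiseCost_nonneg)) hJ
  have hb : ∀ t, (L.stateMoment K t).trace ≤
      specNorm L.S⁻¹ * ((L.gainCost K * L.stateMoment K t).trace + L.noiseCost) := fun t => by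
    have h1 := mul_trace_le_trace_mul (hM t) (M := specNorm L.S⁻¹ • L.S) (c := 1)
      (by simp [Matrix.IsSymm, hL.posDef_S.posSemidef.isSymm.eq]) fun y => by
        simpa [smul_mulVec] using dot_self_le_specNorm_inv hL.posDef_S y
    have h2 : (L.S * L.stateMoment K t).trace ≤ (L.gainCost K * L.stateMoment K t).trace := by
      rw [gainCost, add_mul, trace_add]
      exact le_add_of_nonneg_right (trace_mul_nonneg (hL.posDef_R.posSemidef.conj K) (hM t))
    rw [one_mul, mul_smul_comm, trace_smul, trace_mul_comm, smul_eq_mul] at h1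
    exact h1.trans (mul_le_mul_of_nonneg_left (h2.trans (le_add_of_nonneg_right hL.noiseCost_nonneg))
      (specNorm_nonneg _))
  refine Pi.hasSum.mpr fun i => Pi.hasSum.mpr fun j => ?_
  have hsum : Summable fun t => (γ ^ t • L.stateMoment K t) i j := by
    refine .of_norm_bounded (hs.mul_left (specNorm L.S⁻¹)) fun t => ?_
    rw [Matrix.smul_apply, smul_eq_mul, norm_mul, Real.norm_of_nonneg (pow_nonneg h0 t),
      mul_left_comm]
    exact mul_le_mul_of_nonneg_left (((hM t).abs_apply_le_trace i j).trans (hb t))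
      (pow_nonneg h0 t)
  convert hsum.hasSum using 1
  refine tsum_congr fun t => ?_
  rw [integral_const_mul, ← hL.crossMoment_state]
  rfl

theorem Standing.sigmaMat_posSemidef (hL : L.Standing) {γ : ℝ} (h0 : 0 ≤ γ)
    {K : Matrix (Fin d) (Fin n) ℝ} (hJ : L.JExt γ K ≠ ∞) : (L.SigmaMat γ K).PosSemidef :=
  (hL.hasSum_sigmaMat h0 hJ).posSemidef fun t =>
    (hL.stateMoment_posSemidef K t).smul (pow_nonneg h0 t)

theorem Standing.sigmaMat_eq (hL : L.Standing) {γ : ℝ} (h0 : 0 ≤ γ) (h1 : γ < 1)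
    {K : Matrix (Fin d) (Fin n) ℝ} (hJ : L.JExt γ K ≠ ∞) :
    L.SigmaMat γ K =
      γ • (L.loop K * L.SigmaMat γ K * (L.loop K)ᵀ) + (γ / (1 - γ)) • L.DTilde := by
  have hs := hL.hasSum_sigmaMat h0 hJ
  have e1 := (((hs.mul_left (L.loop K)).mul_right (L.loop K)ᵀ).const_smul γ).add
    ((hasSum_geometric_of_lt_one h0 h1).smul_const (γ • L.DTilde))
  -- Dropping the term t = 0 changes nothing since x₀ = 0; the remaining terms obey the moment
  -- recursion.
  have e2 := (hasSum_nat_add_iff' 1).mpr hs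
  simp only [Finset.range_one, Finset.sum_singleton, stateMoment, momentSeq, smul_zero,
    sub_zero] at e2
  rw [smul_smul, inv_mul_eq_div] at e1
  refine e2.unique (e1.congr_terms fun t => ?_)
  simp only [stateMoment, smul_add, mul_smul_comm, smul_mul_assoc, smul_smul, pow_succ, mul_comm]

theorem Standing.J_eq (hL : L.Standing) {γ : ℝ} (h0 : 0 ≤ γ) (h1 : γ < 1)
    {K : Matrix (Fin d) (Fin n) ℝ} (hJ : L.JExt γ K ≠ ∞) :
    L.J γ K = (L.gainCost K * L.SigmaMat γ K).trace + L.noiseCost / (1 - γ) := by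
  rw [J, hL.JExt_eq h0]
  refine toReal_tsum_ofReal (fun t => mul_nonneg (pow_nonneg h0 t) (add_nonneg
    (trace_mul_nonneg (hL.gainCost_posSemidef K) (hL.stateMoment_posSemidef K t))
    hL.noiseCost_nonneg)) ?_
  have := ((hL.hasSum_sigmaMat h0 hJ).trace_mul (L.gainCost K)).add
    ((hasSum_geometric_of_lt_one h0 h1).mul_right L.noiseCost)
  rw [inv_mul_eq_div] at this
  convert this using 2 with t
  rw [mul_add, mul_smul_comm, trace_smul, smul_eq_mul]

/-- Summation by parts: the Lyapunov equation of `Σ` tested against a matrix `P`. -/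
theorem Standing.trace_mul_DTilde (hL : L.Standing) {γ : ℝ} (h0 : 0 ≤ γ) (h1 : γ < 1)
    {K : Matrix (Fin d) (Fin n) ℝ} (hJ : L.JExt γ K ≠ ∞) (P : Matrix (Fin n) (Fin n) ℝ) :
    γ / (1 - γ) * (P * L.DTilde).trace =
      ((P - γ • ((L.loop K)ᵀ * P * L.loop K)) * L.SigmaMat γ K).trace := by
  have := congrArg (fun X => (P * X).trace) (hL.sigmaMat_eq h0 h1 hJ)
  simp only [mul_add, trace_add, mul_smul_comm, trace_smul, smul_eq_mul] at this
  rw [sub_mul, trace_sub, this, smul_mul_assoc, trace_smul, smul_eq_mul]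
  have e : (P * (L.loop K * L.SigmaMat γ K * (L.loop K)ᵀ)).trace =
      ((L.loop K)ᵀ * P * L.loop K * L.SigmaMat γ K).trace := by
    rw [← mul_assoc, trace_mul_comm, ← mul_assoc, ← mul_assoc]
  rw [e]
  ring

/-! ### The state-action value -/

theorem traj_const (K : Matrix (Fin d) (Fin n) ℝ) (z : (Fin n → ℝ) × (Fin d → ℝ)) (t : ℕ) (w : Ω) :
    L.traj K (fun _ => z) (t + 1) w = ((L.traj K (fun _ => z) (t + 1) w).1,
      K *ᵥ (L.traj K (fun _ => z) (t + 1) w).1 + (L.η (t + 1) w).ofLp) := by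
  simp [traj]

theorem crossMoment_const_left (y : Fin n → ℝ) {a : ℕ}
    {f : Ω → Fin a → ℝ} (hf : ∀ i, ∫ w, f w i ∂L.P = 0) :
    crossMoment L.P (fun _ => y) f = 0 := by
  ext i j
  simp [crossMoment, integral_const_mul, hf]

theorem Standing.integral_noiseTilde (hL : L.Standing) (t : ℕ) (i : Fin n) :
    ∫ w, L.noiseTilde t w i ∂L.P = 0 := by
  have := hL.prob
  have h2 : Integrable (fun w => (L.B *ᵥ (L.η t w).ofLp) i) L.P :=
    ((hL.l2_η t).mulVec L.B i).integrable (by norm_num)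
  simp only [noiseTilde, Pi.add_apply]
  rw [integral_add h2 ((hL.l2_ω t i).integrable (by norm_num)),
    integral_coord_of_hasLaw (hL.law_ω t), add_zero]
  simp only [mulVec, dotProduct]
  rw [integral_finsetSum _ fun k _ => ((hL.l2_η t k).integrable (by norm_num)).const_mul _]
  simp [integral_const_mul, integral_coord_of_hasLaw (hL.law_η t)]

theorem Standing.isClosedLoop_const (hL : L.Standing) (K : Matrix (Fin d) (Fin n) ℝ)
    (z : (Fin n → ℝ) × (Fin d → ℝ)) :
    L.IsClosedLoop K 1 fun t w => (L.traj K (fun _ => z) (t + 1) w).1 where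
  l2_zero := by
    have := hL.prob
    exact (L2Vec.const (L.A *ᵥ z.1 + L.B *ᵥ z.2)).add (hL.l2_ω 0)
  zero_noise r := by
    have := hL.prob
    have h := crossMoment_add_left (L2Vec.const (L.A *ᵥ z.1 + L.B *ᵥ z.2)) (hL.l2_ω 0)
      (hL.l2_noiseTilde (r + 1))
    rw [crossMoment_const_left _ (hL.integral_noiseTilde _),
      hL.crossMoment_ω_noiseTilde (by lia), add_zero] at h
    exact h
  zero_η r := by
    have := hL.prob
    have h := crossMoment_add_left (L2Vec.const (L.A *ᵥ z.1 + L.B *ᵥ z.2)) (hL.l2_ω 0)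
      (hL.l2_η (r + 1))
    rw [crossMoment_const_left _ (integral_coord_of_hasLaw (hL.law_η _)),
      hL.crossMoment_ω_η, add_zero] at h
    exact h
  step t := by
    funext w
    rw [traj, traj_const]
    simp only [loop, noiseTilde, mulVec_add, add_mulVec, mulVec_mulVec, add_assoc]

theorem Standing.crossMoment_const (hL : L.Standing) (K : Matrix (Fin d) (Fin n) ℝ)
    (z : (Fin n → ℝ) × (Fin d → ℝ)) :
    crossMoment L.P (fun w => (L.traj K (fun _ => z) (0 + 1) w).1)
      (fun w => (L.traj K (fun _ => z) (0 + 1) w).1) =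
    vecMulVec (L.A *ᵥ z.1 + L.B *ᵥ z.2) (L.A *ᵥ z.1 + L.B *ᵥ z.2) +
      crossMoment L.P (fun w => (L.ω 0 w).ofLp) (fun w => (L.ω 0 w).ofLp) := by
  have := hL.prob
  have h := crossMoment_mulVec_add_self (L2Vec.const (L.A *ᵥ z.1 + L.B *ᵥ z.2)) (hL.l2_ω 0)
    (crossMoment_const_left _ (integral_coord_of_hasLaw (hL.law_ω _))) 1
  simp only [one_mulVec, one_mul, transpose_one, mul_one] at h
  refine Eq.trans h ?_
  congr 1
  ext i j
  simp [crossMoment, vecMulVec_apply]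

/-- After one step the mean state is y = A x + B u. By `momentSeq_add` the later moments split into
the propagation of y yᵀ, which sums to the form of P at y, and a part independent of (x, u), which
goes into c. -/
theorem Standing.exists_Q_eq (hL : L.Standing) {γ : ℝ} (h0 : 0 ≤ γ) (h1 : γ < 1)
    {K : Matrix (Fin d) (Fin n) ℝ} (hK : L.Stable K) {P : Matrix (Fin n) (Fin n) ℝ}
    (hP : HasSum (fun t : ℕ => γ ^ t • ((L.loop K ^ t)ᵀ * L.gainCost K * L.loop K ^ t)) P) :
    ∃ c : ℝ, ∀ x u, (L.Q γ K x u).toReal = L.stageCost (x, u) +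
      γ * ((L.A *ᵥ x + L.B *ᵥ u) ⬝ᵥ (P *ᵥ (L.A *ᵥ x + L.B *ᵥ u))) + c := by
  have := hL.prob
  set C := crossMoment L.P (fun w => (L.ω 0 w).ofLp) (fun w => (L.ω 0 w).ofLp) with hC
  have hCp : C.PosSemidef := crossMoment_self_posSemidef (hL.l2_ω 0)
  have hs := (summable_trace_momentSeq (A := L.loop K) hK hL.posDef_DTilde.posSemidef hCp
    (hL.gainCost_posSemidef K) h0 h1).add
      ((summable_geometric_of_lt_one h0 h1).mul_right L.noiseCost)
  refine ⟨γ * ∑' t, (γ ^ t * (L.gainCost K * momentSeq (L.loop K) L.DTilde C t).trace +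
    γ ^ t * L.noiseCost), fun x u => ?_⟩
  set y := L.A *ᵥ x + L.B *ᵥ u with hy
  have hpr := hL.isClosedLoop_const K (x, u)
  have hQ : L.Q γ K x u = ∑' t, ENNReal.ofReal (match t with
      | 0 => L.stageCost (x, u)
      | t + 1 => γ ^ (t + 1) * ((L.gainCost K * (L.loop K ^ t * vecMulVec y y * (L.loop K ^ t)ᵀ +
          momentSeq (L.loop K) L.DTilde C t)).trace + L.noiseCost)) := by
    refine tsum_congr fun t => ?_
    cases t with
    | zero => simp [traj]
    | succ t =>
      dsimp only
      rw [← momentSeq_add, hy, hC, ← hL.crossMoment_const K (x, u), ← hpr.crossMoment_self hL,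
        ← hpr.lintegral_stageCost hL t (pow_nonneg h0 (t + 1))]
      refine lintegral_congr fun w => ?_
      conv_lhs => rw [traj_const]
  have hyy : (vecMulVec y y).PosSemidef := by simpa using posSemidef_vecMulVec_self_star y
  rw [hQ]
  refine toReal_tsum_ofReal (fun t => ?_) ((hasSum_nat_add_iff' 1).mp ?_)
  · cases t with
    | zero => exact hL.stageCost_nonneg _
    | succ t =>
      exact mul_nonneg (pow_nonneg h0 _) (add_nonneg (trace_mul_nonneg (hL.gainCost_posSemidef K)
        ((hyy.conj' _).add (momentSeq_posSemidef hL.posDef_DTilde.posSemidef hCp t)))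
        hL.noiseCost_nonneg)
  · have h2 := ((hP.quadForm y).mul_left γ).add (hs.hasSum.mul_left γ)
    simp only [Finset.range_one, Finset.sum_singleton]
    rw [show ∀ p q r : ℝ, p + q + r - p = q + r from fun p q r => by ring]
    refine h2.congr_terms fun t => ?_
    · have e : (L.gainCost K * (L.loop K ^ t * vecMulVec y y * (L.loop K ^ t)ᵀ)).trace =
          y ⬝ᵥ (((L.loop K ^ t)ᵀ * L.gainCost K * L.loop K ^ t) *ᵥ y) := by
        rw [← dot_vecMulVec_mul, ← mul_assoc, trace_mul_comm, ← mul_assoc, ← mul_assoc]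
      rw [mul_add (L.gainCost K), trace_add, e, smul_mulVec, dotProduct_smul, smul_eq_mul, pow_succ]
      ring

theorem quadForm_unique {ι : Type*} [Fintype ι] [DecidableEq ι] {M N : Matrix ι ι ℝ}
    (hM : M.IsSymm) (hN : N.IsSymm) {c c' : ℝ}
    (h : ∀ z : ι → ℝ, z ⬝ᵥ (M *ᵥ z) + c = z ⬝ᵥ (N *ᵥ z) + c') : M = N := by
  have hc : c = c' := by simpa using h 0
  subst hc
  have h2 : ∀ z : ι → ℝ, z ⬝ᵥ (M *ᵥ z) = z ⬝ᵥ (N *ᵥ z) := fun z => by linarith [h z]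
  have hd : ∀ i, M i i = N i i := fun i => by simpa using h2 (Pi.single i 1)
  ext i j
  have hMs : M j i = M i j := congrFun (congrFun hM i) j
  have hNs : N j i = N i j := congrFun (congrFun hN i) j
  have h3 := h2 (Pi.single i 1 + Pi.single j 1)
  simp only [mulVec_add, add_dotProduct, mulVec_single, dotProduct_add, single_dotProduct,
    MulOpposite.op_one, one_smul, one_mul, col_apply, hMs, hNs, hd] at h3
  linarith

/-- The parameters of the state-action value `Q_K`, for the cost-to-go matrix `P` of `K`. -/
def qMatrix (L : LQR n d Ω) (γ : ℝ) (P : Matrix (Fin n) (Fin n) ℝ) :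
    Matrix (Fin n ⊕ Fin d) (Fin n ⊕ Fin d) ℝ :=
  fromBlocks (L.S + γ • (L.Aᵀ * P * L.A)) (γ • (L.Aᵀ * P * L.B)) (γ • (L.Bᵀ * P * L.A))
    (L.R + γ • (L.Bᵀ * P * L.B))

theorem Standing.eq_qMatrix (hL : L.Standing) {γ : ℝ} (h0 : 0 ≤ γ) (h1 : γ < 1)
    {K : Matrix (Fin d) (Fin n) ℝ} (hK : L.Stable K) {P : Matrix (Fin n) (Fin n) ℝ}
    (hPs : P.IsSymm)
    (hP : HasSum (fun t : ℕ => γ ^ t • ((L.loop K ^ t)ᵀ * L.gainCost K * L.loop K ^ t)) P)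
    {Θ : Matrix (Fin n ⊕ Fin d) (Fin n ⊕ Fin d) ℝ} {Θ₀ : ℝ} (hΘ : L.IsQParam γ K Θ Θ₀) :
    Θ = L.qMatrix γ P := by
  obtain ⟨c, hc⟩ := hL.exists_Q_eq h0 h1 hK hP
  refine quadForm_unique (c := Θ₀) (c' := c) hΘ.1 ?_ fun z => ?_
  · rw [Matrix.IsSymm, qMatrix, fromBlocks_transpose]
    simp only [transpose_add, transpose_smul, transpose_mul, transpose_transpose, hPs.eq,
      hL.posDef_S.posSemidef.isSymm.eq, hL.posDef_R.posSemidef.isSymm.eq, Matrix.mul_assoc]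
  · have e : Sum.elim (z ∘ Sum.inl) (z ∘ Sum.inr) = z := Sum.elim_comp_inl_inr z
    have h := (hΘ.2 (z ∘ Sum.inl) (z ∘ Sum.inr)).2
    rw [hc, QTilde, e] at h
    rw [← h, ← e]
    generalize z ∘ Sum.inl = x
    generalize z ∘ Sum.inr = u
    rw [qMatrix, fromBlocks_mulVec]
    simp only [stageCost, Function.comp_def, Sum.elim_inl, Sum.elim_inr, sumElim_dotProduct_sumElim,
      add_mulVec, smul_mulVec, dotProduct_add, dotProduct_smul, mulVec_add, add_dotProduct,
      ← mulVec_mulVec, dot_mulVec_transpose, smul_eq_mul]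
    ring

end LQR


namespace LQR

variable {n d : ℕ} {Ω : Type*} [MeasurableSpace Ω] {L : LQR n d Ω}

/-! ### Completing the square -/

/-- The action-action block `R + γ Bᵀ P B` of the parameters of the state-action value. -/
def actionBlock (L : LQR n d Ω) (γ : ℝ) (P : Matrix (Fin n) (Fin n) ℝ) :
    Matrix (Fin d) (Fin d) ℝ := L.R + γ • (L.Bᵀ * P * L.B)

/-- The greedy gain `-(R + γ Bᵀ P B)⁻¹ (γ Bᵀ P A)`. -/
def greedy (L : LQR n d Ω) (γ : ℝ) (P : Matrix (Fin n) (Fin n) ℝ) : Matrix (Fin d) (Fin n) ℝ :=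
  -((L.actionBlock γ P)⁻¹ * (γ • (L.Bᵀ * P * L.A)))

/-- The loss `(K - K')ᵀ (R + γ Bᵀ P B) (K - K')` against the greedy gain `K'`. -/
def gap (L : LQR n d Ω) (γ : ℝ) (P : Matrix (Fin n) (Fin n) ℝ) (K : Matrix (Fin d) (Fin n) ℝ) :
    Matrix (Fin n) (Fin n) ℝ :=
  (K - L.greedy γ P)ᵀ * L.actionBlock γ P * (K - L.greedy γ P)

/-- One step of the value recursion, `S + Kᵀ R K + γ (A + B K)ᵀ P (A + B K)`. -/
def bellman (L : LQR n d Ω) (γ : ℝ) (P : Matrix (Fin n) (Fin n) ℝ)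
    (K : Matrix (Fin d) (Fin n) ℝ) : Matrix (Fin n) (Fin n) ℝ :=
  L.gainCost K + γ • ((L.loop K)ᵀ * P * L.loop K)

theorem Standing.actionBlock_posDef (hL : L.Standing) {γ : ℝ} (h0 : 0 ≤ γ)
    {P : Matrix (Fin n) (Fin n) ℝ} (hP : P.PosSemidef) : (L.actionBlock γ P).PosDef :=
  hL.posDef_R.add_posSemidef ((hP.conj L.B).smul h0)

theorem Standing.actionBlock_mul_greedy (hL : L.Standing) {γ : ℝ} (h0 : 0 ≤ γ)
    {P : Matrix (Fin n) (Fin n) ℝ} (hP : P.PosSemidef) :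
    L.actionBlock γ P * L.greedy γ P = -(γ • (L.Bᵀ * P * L.A)) := by
  have hu := (Matrix.isUnit_iff_isUnit_det _).mp (hL.actionBlock_posDef h0 hP).isUnit
  rw [greedy, Matrix.mul_neg, Matrix.mul_nonsing_inv_cancel_left _ _ hu]

theorem Standing.gap_posSemidef (hL : L.Standing) {γ : ℝ} (h0 : 0 ≤ γ)
    {P : Matrix (Fin n) (Fin n) ℝ} (hP : P.PosSemidef) (K : Matrix (Fin d) (Fin n) ℝ) :
    (L.gap γ P K).PosSemidef :=
  (hL.actionBlock_posDef h0 hP).posSemidef.conj _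

/-- Completing the square in K: the linear terms of the recursion are absorbed by the normal
equation `actionBlock_mul_greedy`, so K survives only in the gap. -/
theorem Standing.bellman_eq (hL : L.Standing) {γ : ℝ} (h0 : 0 ≤ γ)
    {P : Matrix (Fin n) (Fin n) ℝ} (hP : P.PosSemidef) (K : Matrix (Fin d) (Fin n) ℝ) :
    L.bellman γ P K = L.S + γ • (L.Aᵀ * P * L.A) -
      (L.greedy γ P)ᵀ * L.actionBlock γ P * L.greedy γ P + L.gap γ P K := by
  have h1 := hL.actionBlock_mul_greedy h0 hP
  have h2 : (L.greedy γ P)ᵀ * L.actionBlock γ P = -(γ • (L.Aᵀ * P * L.B)) := by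
    have := congrArg transpose h1
    rw [transpose_mul, (hL.actionBlock_posDef h0 hP).posSemidef.isSymm.eq] at this
    rw [this]
    simp only [transpose_neg, transpose_smul, transpose_mul, transpose_transpose, hP.isSymm.eq,
      Matrix.mul_assoc]
  have h3 : L.gap γ P K = Kᵀ * L.actionBlock γ P * K + γ • (Kᵀ * (L.Bᵀ * P * L.A)) +
      γ • (L.Aᵀ * P * L.B * K) + (L.greedy γ P)ᵀ * L.actionBlock γ P * L.greedy γ P := by
    rw [gap, transpose_sub, Matrix.sub_mul, Matrix.sub_mul, Matrix.mul_sub, Matrix.mul_sub,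
      Matrix.mul_assoc Kᵀ _ (L.greedy γ P), h1, h2]
    simp only [Matrix.mul_neg, Matrix.neg_mul, Matrix.mul_smul, Matrix.smul_mul]
    abel
  rw [h3, bellman, gainCost, loop, actionBlock]
  simp only [transpose_add, transpose_mul, Matrix.add_mul, Matrix.mul_add, smul_add,
    Matrix.mul_assoc, Matrix.mul_smul, Matrix.smul_mul]
  abel

theorem Standing.bellman_add_gap (hL : L.Standing) {γ : ℝ} (h0 : 0 ≤ γ)
    {P : Matrix (Fin n) (Fin n) ℝ} (hP : P.PosSemidef) (K K' : Matrix (Fin d) (Fin n) ℝ) :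
    L.bellman γ P K + L.gap γ P K' = L.bellman γ P K' + L.gap γ P K := by
  rw [hL.bellman_eq h0 hP K, hL.bellman_eq h0 hP K', add_right_comm]

/-- The greedy gain `K'` satisfies `K'ᵀ (R + γ Bᵀ P B) K' ≤ γ Aᵀ P A`. -/
theorem Standing.greedy_quad_le (hL : L.Standing) {γ : ℝ} (h0 : 0 ≤ γ)
    {P : Matrix (Fin n) (Fin n) ℝ} (hP : P.PosSemidef) (v : Fin n → ℝ) :
    (L.greedy γ P *ᵥ v) ⬝ᵥ (L.actionBlock γ P *ᵥ (L.greedy γ P *ᵥ v)) ≤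
      γ * ((L.A *ᵥ v) ⬝ᵥ (P *ᵥ (L.A *ᵥ v))) := by
  -- At the greedy gain the gap vanishes; what remains of the Bellman value beyond S is nonnegative.
  -- This bounds the greedy gain without any norm of B.
  have h := congrArg (fun M => v ⬝ᵥ (M *ᵥ v)) (hL.bellman_eq h0 hP (L.greedy γ P))
  simp only [bellman, gainCost, gap, sub_self, Matrix.mul_zero, add_zero, add_mulVec, sub_mulVec,
    smul_mulVec, dotProduct_add, dotProduct_sub, dotProduct_smul, dot_conj_mulVec,
    smul_eq_mul] at h
  have h1 := hL.posDef_R.posSemidef.dot_nonneg (L.greedy γ P *ᵥ v)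
  have h2 := mul_nonneg h0 (hP.dot_nonneg (L.loop (L.greedy γ P) *ᵥ v))
  linarith

/-! ### Cost differences -/

section CostToGo

variable {γ : ℝ} {K : Matrix (Fin d) (Fin n) ℝ} {P : Matrix (Fin n) (Fin n) ℝ}

theorem Standing.J_eq_trace (hL : L.Standing) (h0 : 0 ≤ γ) (h1 : γ < 1)
    (hJ : L.JExt γ K ≠ ∞) (hP : P = L.bellman γ P K) :
    L.J γ K = γ / (1 - γ) * (P * L.DTilde).trace + L.noiseCost / (1 - γ) := by
  have e : P - γ • ((L.loop K)ᵀ * P * L.loop K) = L.gainCost K := by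
    rw [sub_eq_iff_eq_add]
    exact hP
  rw [hL.J_eq h0 h1 hJ, hL.trace_mul_DTilde h0 h1 hJ P, e]

/-- P solves the recursion of K, so its Bellman residual at K' is gap(K') - gap(K); this residual is
summed against Σ_{K'}. -/
theorem Standing.J_sub_J (hL : L.Standing) (h0 : 0 ≤ γ) (h1 : γ < 1)
    (hJ : L.JExt γ K ≠ ∞) (hPs : P.PosSemidef) (hP : P = L.bellman γ P K)
    {K' : Matrix (Fin d) (Fin n) ℝ} (hJ' : L.JExt γ K' ≠ ∞) :
    L.J γ K' - L.J γ K =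
      (L.gap γ P K' * L.SigmaMat γ K').trace - (L.gap γ P K * L.SigmaMat γ K').trace := by
  have e : L.bellman γ P K' - P = L.gap γ P K' - L.gap γ P K := by
    rw [sub_eq_sub_iff_add_eq_add, hL.bellman_add_gap h0 hPs K' K, ← hP, add_comm]
  rw [hL.J_eq_trace h0 h1 hJ hP, hL.trace_mul_DTilde h0 h1 hJ' P, hL.J_eq h0 h1 hJ',
    ← trace_sub, ← sub_mul, ← e, bellman, sub_mul, sub_mul, add_mul, trace_sub, trace_sub, trace_add]
  ring

theorem Standing.sigmaMat_ge (hL : L.Standing) [Nonempty (Fin n)] (h0 : 0 ≤ γ) (h1 : γ < 1)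
    (hJ : L.JExt γ K ≠ ∞) (y : Fin n → ℝ) :
    γ * sigmaMin L.DTilde / (1 - γ) * (y ⬝ᵥ y) ≤ y ⬝ᵥ (L.SigmaMat γ K *ᵥ y) := by
  have h := congrArg (fun M => y ⬝ᵥ (M *ᵥ y)) (hL.sigmaMat_eq h0 h1 hJ)
  simp only [add_mulVec, smul_mulVec, dotProduct_add, dotProduct_smul, smul_eq_mul] at h
  rw [h]
  have h2 := mul_nonneg h0 (((hL.sigmaMat_posSemidef h0 hJ).conj' (L.loop K)).dot_nonneg y)
  have h3 := mul_le_mul_of_nonneg_left (sigmaMin_mul_dot_le hL.posDef_DTilde y)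
    (div_nonneg h0 (sub_nonneg.mpr h1.le))
  calc _ = γ / (1 - γ) * (sigmaMin L.DTilde * (y ⬝ᵥ y)) := by ring
    _ ≤ _ := by linarith

theorem Standing.le_specNorm_sigmaMat (hL : L.Standing) [Nonempty (Fin n)] (h0 : 0 ≤ γ) (h1 : γ < 1)
    (hJ : L.JExt γ K ≠ ∞) :
    γ * sigmaMin L.DTilde / (1 - γ) ≤ specNorm (L.SigmaMat γ K) := by
  let i : Fin n := Classical.arbitrary _
  have h2 := (hL.sigmaMat_ge h0 h1 hJ (Pi.single i 1)).trans (dot_mulVec_le_specNorm _ _)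
  simpa using h2

theorem Standing.le_J (hL : L.Standing) [Nonempty (Fin n)] (h0 : 0 ≤ γ) (h1 : γ < 1)
    (hJ : L.JExt γ K ≠ ∞) :
    sigmaMin L.S * (γ * sigmaMin L.DTilde / (1 - γ)) ≤ L.J γ K := by
  have hsig := hL.sigmaMat_posSemidef h0 hJ
  have h2 : γ * sigmaMin L.DTilde / (1 - γ) ≤ (L.SigmaMat γ K).trace := by
    let i : Fin n := Classical.arbitrary _
    have := (hL.sigmaMat_ge h0 h1 hJ (Pi.single i 1)).trans (dot_mulVec_le_trace hsig _)
    simpa using this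
  have h3 := mul_trace_le_trace_mul hsig hL.posDef_S.posSemidef.isSymm
    (sigmaMin_mul_dot_le hL.posDef_S)
  have h4 := trace_mul_nonneg (hL.posDef_R.posSemidef.conj K) hsig
  have h5 := div_nonneg hL.noiseCost_nonneg (sub_nonneg.mpr h1.le)
  rw [hL.J_eq h0 h1 hJ, gainCost, add_mul, trace_add, trace_mul_comm L.S]
  have := mul_le_mul_of_nonneg_left h2 (sigmaMin_pos hL.posDef_S).le
  linarith

theorem Standing.trace_le (hL : L.Standing) [Nonempty (Fin n)] (h0 : 0 < γ) (h1 : γ < 1)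
    (hJ : L.JExt γ K ≠ ∞) (hPs : P.PosSemidef) (hP : P = L.bellman γ P K) :
    P.trace ≤ (1 - γ) * L.J γ K / (γ * sigmaMin L.DTilde) := by
  have hσ := sigmaMin_pos hL.posDef_DTilde
  have h2 := mul_trace_le_trace_mul hPs hL.posDef_DTilde.posSemidef.isSymm
    (sigmaMin_mul_dot_le hL.posDef_DTilde)
  rw [hL.J_eq_trace h0.le h1 hJ hP, le_div_iff₀ (by positivity), mul_add]
  have h3 : (1 - γ) * (γ / (1 - γ) * (P * L.DTilde).trace) = γ * (P * L.DTilde).trace := by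
    field_simp [(sub_pos.mpr h1).ne']
  have h4 : (1 - γ) * (L.noiseCost / (1 - γ)) = L.noiseCost := by
    field_simp [(sub_pos.mpr h1).ne']
  rw [h3, h4]
  nlinarith [hL.noiseCost_nonneg, mul_le_mul_of_nonneg_left h2 h0.le]

end CostToGo

/-! ### The approximate improvement step -/

section Perturbation

/-- With q = yᵀ G y and w = (G + D) y, the smallness of ε gives |yᵀ D y| ≤ q/2, hence q/2 ≤ y ⬝ w.
Cauchy–Schwarz then yields (q/2)² ≤ r q ‖w‖². -/
theorem perturbed_quad_le {d : ℕ} {R G D : Matrix (Fin d) (Fin d) ℝ} {r ε : ℝ} (hr : 0 < r)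
    (hR : ∀ y, y ⬝ᵥ y ≤ r * (y ⬝ᵥ (R *ᵥ y))) (hG : (G - R).PosSemidef) (hε : 0 ≤ ε)
    (hεr : ε ≤ 1 / (2 * r)) (hD : ∀ y, (D *ᵥ y) ⬝ᵥ (D *ᵥ y) ≤ ε ^ 2 * (y ⬝ᵥ y)) (y : Fin d → ℝ) :
    y ⬝ᵥ y ≤ r * (y ⬝ᵥ (G *ᵥ y)) ∧
    y ⬝ᵥ (G *ᵥ y) ≤ 4 * r * (((G + D) *ᵥ y) ⬝ᵥ ((G + D) *ᵥ y)) := by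
  set q := y ⬝ᵥ (G *ᵥ y) with hq
  set w := (G + D) *ᵥ y with hw
  have h1 : y ⬝ᵥ y ≤ r * q := by
    refine (hR y).trans (mul_le_mul_of_nonneg_left ?_ hr.le)
    have := hG.dot_nonneg y
    rw [sub_mulVec, dotProduct_sub] at this
    linarith
  refine ⟨h1, ?_⟩
  have hyy := dot_self_nonneg y
  have hq0 : 0 ≤ q := nonneg_of_mul_nonneg_right (hyy.trans h1) hr
  have h2 : |y ⬝ᵥ (D *ᵥ y)| ≤ ε * (y ⬝ᵥ y) := by
    refine abs_le_of_sq_le_sq ?_ (by positivity)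
    calc _ ≤ (y ⬝ᵥ y) * ((D *ᵥ y) ⬝ᵥ (D *ᵥ y)) := dot_sq_le _ _
      _ ≤ (y ⬝ᵥ y) * (ε ^ 2 * (y ⬝ᵥ y)) := mul_le_mul_of_nonneg_left (hD y) hyy
      _ = _ := by ring
  have h3 : ε * (y ⬝ᵥ y) ≤ q / 2 := by
    calc _ ≤ 1 / (2 * r) * (r * q) := mul_le_mul hεr h1 hyy (by positivity)
      _ = _ := by field_simp
  have h4 : q = y ⬝ᵥ w - y ⬝ᵥ (D *ᵥ y) := by
    rw [hw, add_mulVec, dotProduct_add, hq]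
    ring
  have h5 : q / 2 ≤ y ⬝ᵥ w := by linarith [(abs_le.mp h2).1]
  have h6 := dot_sq_le y w
  have hww := dot_self_nonneg w
  have h7 : (q / 2) ^ 2 ≤ r * q * (w ⬝ᵥ w) :=
    (pow_le_pow_left₀ (by positivity) h5 2).trans (h6.trans (mul_le_mul_of_nonneg_right h1 hww))
  rcases hq0.eq_or_lt with h | h
  · rw [← h]
    positivity
  · nlinarith

theorem perturbed_isUnit_det {d : ℕ} {R G D : Matrix (Fin d) (Fin d) ℝ} {r ε : ℝ} (hr : 0 < r)
    (hR : ∀ y, y ⬝ᵥ y ≤ r * (y ⬝ᵥ (R *ᵥ y))) (hG : (G - R).PosSemidef) (hε : 0 ≤ ε)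
    (hεr : ε ≤ 1 / (2 * r)) (hD : ∀ y, (D *ᵥ y) ⬝ᵥ (D *ᵥ y) ≤ ε ^ 2 * (y ⬝ᵥ y)) :
    IsUnit (G + D).det := by
  rw [isUnit_iff_ne_zero]
  intro h
  obtain ⟨y, hy, h0⟩ := Matrix.exists_mulVec_eq_zero_iff.mpr h
  obtain ⟨h1, h2⟩ := perturbed_quad_le hr hR hG hε hεr hD y
  rw [h0] at h2
  have := dot_self_pos hy
  simp only [dotProduct_zero, mul_zero] at h2
  nlinarith

variable {γ ε₀ p : ℝ} {P : Matrix (Fin n) (Fin n) ℝ}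
  {Θ : Matrix (Fin n ⊕ Fin d) (Fin n ⊕ Fin d) ℝ}

theorem Standing.improvement (hL : L.Standing) [Nonempty (Fin d)] (h0 : 0 ≤ γ) (h1 : γ ≤ 1)
    (hP : P.PosSemidef) (hp : P.trace ≤ p) (hΘ : frobNorm (Θ - L.qMatrix γ P) ≤ ε₀)
    (hε : ε₀ ≤ 1 / (2 * specNorm L.R⁻¹)) :
    IsUnit Θ.toBlocks₂₂.det ∧ ∀ v, v ⬝ᵥ (L.gap γ P (-(Θ.toBlocks₂₂⁻¹ * Θ.toBlocks₂₁)) *ᵥ v) ≤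
      4 * specNorm L.R⁻¹ * (1 + specNorm L.R⁻¹ * specNorm L.A ^ 2 * p) * ε₀ ^ 2 * (v ⬝ᵥ v) := by
  set r := specNorm L.R⁻¹ with hr
  set Δ := Θ - L.qMatrix γ P with hΔ
  have hr0 : 0 < r := specNorm_inv_pos hL.posDef_R
  have hf0 := frobNorm_nonneg Δ
  have hε0 : 0 ≤ ε₀ := hf0.trans hΘ
  have hR := dot_self_le_specNorm_inv hL.posDef_R
  have hG : (L.actionBlock γ P - L.R).PosSemidef := by
    rw [actionBlock, add_sub_cancel_left]
    exact (hP.conj L.B).smul h0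
  have hblock : ∀ v u, (Δ.toBlocks₂₁ *ᵥ v + Δ.toBlocks₂₂ *ᵥ u) ⬝ᵥ
      (Δ.toBlocks₂₁ *ᵥ v + Δ.toBlocks₂₂ *ᵥ u) ≤ ε₀ ^ 2 * (v ⬝ᵥ v + u ⬝ᵥ u) := fun v u =>
    (toBlocks_mulVec_dot_self_le Δ v u).trans (mul_le_mul_of_nonneg_right
      (pow_le_pow_left₀ hf0 hΘ 2) (add_nonneg (dot_self_nonneg _) (dot_self_nonneg _)))
  have hD : ∀ y, (Δ.toBlocks₂₂ *ᵥ y) ⬝ᵥ (Δ.toBlocks₂₂ *ᵥ y) ≤ ε₀ ^ 2 * (y ⬝ᵥ y) := fun y => by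
    simpa using hblock 0 y
  have h22 : Θ.toBlocks₂₂ = L.actionBlock γ P + Δ.toBlocks₂₂ := by
    ext i j
    simp [hΔ, toBlocks₂₂, qMatrix, actionBlock]
  have h21 : Θ.toBlocks₂₁ = γ • (L.Bᵀ * P * L.A) + Δ.toBlocks₂₁ := by
    ext i j
    simp [hΔ, toBlocks₂₁, qMatrix]
  have hu : IsUnit Θ.toBlocks₂₂.det := by
    rw [h22]
    exact perturbed_isUnit_det hr0 hR hG hε0 hε hD
  refine ⟨hu, fun v => ?_⟩
  set k := L.greedy γ P *ᵥ v with hk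
  -- The error K' - g solves a linear system with matrix Θ₂₂ whose right-hand side contains only the
  -- perturbation; the exact terms cancel by the normal equation of g.
  have hkey : (L.actionBlock γ P + Δ.toBlocks₂₂) *ᵥ
      ((-(Θ.toBlocks₂₂⁻¹ * Θ.toBlocks₂₁) - L.greedy γ P) *ᵥ v) =
        -(Δ.toBlocks₂₁ *ᵥ v + Δ.toBlocks₂₂ *ᵥ k) := by
    have e : (L.actionBlock γ P + Δ.toBlocks₂₂) *
        (-(Θ.toBlocks₂₂⁻¹ * Θ.toBlocks₂₁) - L.greedy γ P) =
          -(Δ.toBlocks₂₁ + Δ.toBlocks₂₂ * L.greedy γ P) := by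
      rw [Matrix.mul_sub, ← h22, Matrix.mul_neg, Matrix.mul_nonsing_inv_cancel_left _ _ hu, h22,
        Matrix.add_mul, hL.actionBlock_mul_greedy h0 hP, h21]
      abel
    rw [mulVec_mulVec, e, neg_mulVec, add_mulVec, ← mulVec_mulVec]
  have h2 := (perturbed_quad_le hr0 hR hG hε0 hε hD
    ((-(Θ.toBlocks₂₂⁻¹ * Θ.toBlocks₂₁) - L.greedy γ P) *ᵥ v)).2
  rw [hkey, neg_dotProduct_neg] at h2
  rw [gap, dot_conj_mulVec]
  have hvv := dot_self_nonneg v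
  have hp0 : 0 ≤ p := hP.trace_nonneg.trans hp
  have hkk : k ⬝ᵥ k ≤ r * specNorm L.A ^ 2 * p * (v ⬝ᵥ v) := by
    calc k ⬝ᵥ k ≤ r * (k ⬝ᵥ (L.actionBlock γ P *ᵥ k)) :=
          (perturbed_quad_le hr0 hR hG hε0 hε hD k).1
      _ ≤ r * (γ * ((L.A *ᵥ v) ⬝ᵥ (P *ᵥ (L.A *ᵥ v)))) :=
          mul_le_mul_of_nonneg_left (hL.greedy_quad_le h0 hP v) hr0.le
      _ ≤ r * (1 * (p * (specNorm L.A ^ 2 * (v ⬝ᵥ v)))) := by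
          refine mul_le_mul_of_nonneg_left (mul_le_mul h1 ?_ (hP.dot_nonneg _) zero_le_one) hr0.le
          refine (dot_mulVec_le_trace hP _).trans (mul_le_mul hp (mulVec_dot_self_le _ _)
            (dot_self_nonneg _) hp0)
      _ = _ := by ring
  calc _ ≤ _ := h2
    _ ≤ 4 * r * (ε₀ ^ 2 * (v ⬝ᵥ v + k ⬝ᵥ k)) := mul_le_mul_of_nonneg_left (hblock v k) (by positivity)
    _ ≤ 4 * r * (ε₀ ^ 2 * (v ⬝ᵥ v + r * specNorm L.A ^ 2 * p * (v ⬝ᵥ v))) := by gcongr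
    _ = _ := by ring

end Perturbation

/-- One step of approximate policy iteration. -/
theorem Standing.policy_step (hL : L.Standing) [Nonempty (Fin n)] [Nonempty (Fin d)]
    {γ ε₀ j e : ℝ} (h0 : 1 / 2 ≤ γ) (h1 : γ < 1) {K Kstar : Matrix (Fin d) (Fin n) ℝ}
    (hK : L.Stable K) (hJs : L.JExt γ Kstar ≠ ∞) (hj : (1 - γ) * L.J γ K ≤ j)
    (hjγ : (1 - γ) * (2 * j / sigmaMin L.DTilde) ≤ sigmaMin L.S / 4)
    (hε : ε₀ ≤ 1 / (2 * specNorm L.R⁻¹))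
    (he : 4 * specNorm L.R⁻¹ * (1 + specNorm L.R⁻¹ * specNorm L.A ^ 2 *
      (2 * j / sigmaMin L.DTilde)) * ε₀ ^ 2 ≤ e) (hes : e ≤ sigmaMin L.S / 2)
    {Θ : Matrix (Fin n ⊕ Fin d) (Fin n ⊕ Fin d) ℝ} (hΘ : L.IsApproxQ γ ε₀ K Θ) :
    IsUnit Θ.toBlocks₂₂.det ∧ L.Stable (-(Θ.toBlocks₂₂⁻¹ * Θ.toBlocks₂₁)) ∧
      L.J γ (-(Θ.toBlocks₂₂⁻¹ * Θ.toBlocks₂₁)) - L.J γ Kstar ≤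
        (1 - γ * sigmaMin L.DTilde / (1 - γ) / specNorm (L.SigmaMat γ Kstar)) *
          (L.J γ K - L.J γ Kstar) + e * (2 * L.J γ K / sigmaMin L.S) := by
  have hγ : 0 < γ := by linarith
  have hσ := sigmaMin_pos hL.posDef_DTilde
  have hs := sigmaMin_pos hL.posDef_S
  have hJ := hL.JExt_ne_top_of_stable hγ.le h1 hK
  obtain ⟨P, hPs, hPe, hPsum⟩ := exists_lyapunov (A := L.loop K) hK (hL.gainCost_posSemidef K)
    hγ.le h1.le
  have hPb : P = L.bellman γ P K := hPe
  have hp : P.trace ≤ 2 * j / sigmaMin L.DTilde := by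
    refine (hL.trace_le hγ h1 hJ hPs hPb).trans ?_
    have hJ0 : 0 ≤ (1 - γ) * L.J γ K := mul_nonneg (sub_nonneg.mpr h1.le) ENNReal.toReal_nonneg
    rw [div_le_div_iff₀ (by positivity) hσ]
    have : (1 - γ) * L.J γ K ≤ 2 * j * γ := by nlinarith
    calc _ ≤ 2 * j * γ * sigmaMin L.DTilde := mul_le_mul_of_nonneg_right this hσ.le
      _ = _ := by ring
  obtain ⟨Θs, Θs₀, hq, hf⟩ := hΘ
  rw [hL.eq_qMatrix hγ.le h1 hK hPs.isSymm hPsum hq] at hf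
  obtain ⟨hu, hgap⟩ := hL.improvement hγ.le h1.le hPs hp hf hε
  set K' := -(Θ.toBlocks₂₂⁻¹ * Θ.toBlocks₂₁) with hK'
  have hgap' : ∀ v, v ⬝ᵥ (L.gap γ P K' *ᵥ v) ≤ e * (v ⬝ᵥ v) := fun v =>
    (hgap v).trans (mul_le_mul_of_nonneg_right he (dot_self_nonneg v))
  -- By `bellman_add_gap` the decrease equals S + K'ᵀ R K' + gap(K) - gap(K'), and gap(K') takes
  -- away at most half of S.
  have hdec : ∀ v, sigmaMin L.S / 2 * (v ⬝ᵥ v) ≤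
      v ⬝ᵥ ((P - γ • ((L.loop K')ᵀ * P * L.loop K')) *ᵥ v) := fun v => by
    have h := congrArg (fun M => v ⬝ᵥ (M *ᵥ v))
      ((hL.bellman_add_gap hγ.le hPs K' K).trans (congrArg (· + L.gap γ P K') hPb.symm))
    simp only [bellman, gainCost, add_mulVec, dotProduct_add] at h
    rw [sub_mulVec, dotProduct_sub]
    have a1 := (hL.gap_posSemidef hγ.le hPs K).dot_nonneg v
    have a2 := (hL.posDef_R.posSemidef.conj K').dot_nonneg v
    have a3 := sigmaMin_mul_dot_le hL.posDef_S v
    have a4 := mul_le_mul_of_nonneg_right hes (dot_self_nonneg v)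
    linarith [hgap' v]
  have hPsym := hPs.isSymm
  have hst : L.Stable K' := by
    refine spectralRadius_lt_one_of_lyapunov (A := L.loop K') hPs (c := sigmaMin L.S / 4)
      (by positivity) (posSemidef_sub_smul_one ?_ fun v => ?_)
    · have := (hPs.conj (L.loop K')).isSymm
      rw [Matrix.IsSymm, transpose_sub, this.eq, hPsym.eq]
    · have a1 := hdec v
      rw [sub_mulVec, smul_mulVec, dotProduct_sub, dotProduct_smul, smul_eq_mul] at a1
      rw [sub_mulVec, dotProduct_sub]
      have hvv := dot_self_nonneg v
      -- Passing from the discounted to the undiscounted Lyapunov inequality costs (1 - γ) P, which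
      -- uses up only half of the available decrease s/2.
      have a2 : (1 - γ) * (v ⬝ᵥ (P *ᵥ v)) ≤ sigmaMin L.S / 4 * (v ⬝ᵥ v) := by
        have := (dot_mulVec_le_trace hPs v).trans (mul_le_mul_of_nonneg_right hp hvv)
        calc _ ≤ (1 - γ) * (2 * j / sigmaMin L.DTilde * (v ⬝ᵥ v)) :=
              mul_le_mul_of_nonneg_left this (sub_nonneg.mpr h1.le)
          _ ≤ _ := by
              rw [← mul_assoc]
              exact mul_le_mul_of_nonneg_right hjγ hvv
      have a3 : sigmaMin L.S / 4 * (v ⬝ᵥ v) ≤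
          γ * (v ⬝ᵥ (P *ᵥ v) - v ⬝ᵥ (((L.loop K')ᵀ * P * L.loop K') *ᵥ v)) := by linarith
      have a4 : 0 ≤ sigmaMin L.S / 4 * (v ⬝ᵥ v) := by positivity
      nlinarith
  refine ⟨hu, hst, ?_⟩
  have hJ' := hL.JExt_ne_top_of_stable hγ.le h1 hst
  have hsig := hL.sigmaMat_posSemidef hγ.le hJ'
  have hsigs := hL.sigmaMat_posSemidef hγ.le hJs
  have hF := hL.gap_posSemidef hγ.le hPs K
  have hF' := hL.gap_posSemidef hγ.le hPs K'
  have hN : 0 < specNorm (L.SigmaMat γ Kstar) :=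
    lt_of_lt_of_le (div_pos (mul_pos hγ hσ) (sub_pos.mpr h1)) (hL.le_specNorm_sigmaMat hγ.le h1 hJs)
  have b1 := hL.J_sub_J hγ.le h1 hJ hPs hPb hJ'
  have b2 := hL.J_sub_J hγ.le h1 hJ hPs hPb hJs
  have b3 := trace_mul_nonneg (hL.gap_posSemidef hγ.le hPs Kstar) hsigs
  have b4 := trace_mul_le_mul_trace hF hsigs.isSymm (dot_mulVec_le_specNorm _)
  have b5 := mul_trace_le_trace_mul hF hsig.isSymm (hL.sigmaMat_ge hγ.le h1 hJ')
  have b6 := trace_mul_le_mul_trace hsig hF'.isSymm hgap'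
  -- Bounds tr Σ_{K'} by the cost of the current K, so no prior bound on J(K') is needed.
  have b7 := mul_trace_le_trace_mul hsig (M := P - γ • ((L.loop K')ᵀ * P * L.loop K')) (by
      have := (hPs.conj (L.loop K')).isSymm
      rw [Matrix.IsSymm, transpose_sub, transpose_smul, this.eq, hPsym.eq]) hdec
  rw [trace_mul_comm, ← hL.trace_mul_DTilde hγ.le h1 hJ' P] at b7
  have b8 := hL.J_eq_trace hγ.le h1 hJ hPb
  have b9 : 0 ≤ L.noiseCost / (1 - γ) := div_nonneg hL.noiseCost_nonneg (sub_nonneg.mpr h1.le)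
  have htr : (L.SigmaMat γ K').trace ≤ 2 * L.J γ K / sigmaMin L.S := by
    rw [le_div_iff₀ hs]
    linarith
  have he0 : 0 ≤ e := by
    let i : Fin n := Classical.arbitrary _
    have := (hF'.dot_nonneg (Pi.single i 1)).trans (hgap' (Pi.single i 1))
    simpa using this
  have c1 := mul_le_mul_of_nonneg_left htr he0
  rw [trace_mul_comm] at b6
  have hcoef : 0 ≤ γ * sigmaMin L.DTilde / (1 - γ) :=
    div_nonneg (by positivity) (sub_nonneg.mpr h1.le)
  have c2 : γ * sigmaMin L.DTilde / (1 - γ) / specNorm (L.SigmaMat γ Kstar) *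
      (L.J γ K - L.J γ Kstar) ≤ γ * sigmaMin L.DTilde / (1 - γ) * (L.gap γ P K).trace := by
    rw [div_mul_eq_mul_div, div_le_iff₀ hN, mul_assoc]
    refine mul_le_mul_of_nonneg_left ?_ hcoef
    linarith
  linarith

/-- For a stable gain, `(1 - γ) J(K)` is bounded uniformly in `γ`. -/
theorem Standing.exists_average_cost_bound (hL : L.Standing) {K : Matrix (Fin d) (Fin n) ℝ}
    (hK : L.Stable K) : ∃ M, 0 ≤ M ∧ ∀ γ : ℝ, 0 ≤ γ → γ < 1 → (1 - γ) * L.J γ K ≤ M := by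
  -- The undiscounted cost-to-go matrix is a supersolution of the recursion for every γ < 1 at once.
  obtain ⟨P, hPs, hPe, -⟩ := exists_lyapunov (A := L.loop K) hK (hL.gainCost_posSemidef K)
    zero_le_one le_rfl
  have hPD := trace_mul_nonneg hPs hL.posDef_DTilde.posSemidef
  refine ⟨(P * L.DTilde).trace + L.noiseCost, add_nonneg hPD hL.noiseCost_nonneg,
    fun γ h0 h1 => ?_⟩
  have hJ := hL.JExt_ne_top_of_stable h0 h1 hK
  have hγ := sub_pos.mpr h1
  have e : P - γ • ((L.loop K)ᵀ * P * L.loop K) =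
      L.gainCost K + (1 - γ) • ((L.loop K)ᵀ * P * L.loop K) := by
    nth_rw 1 [hPe]
    rw [one_smul, sub_smul, one_smul]
    abel
  have h2 := hL.trace_mul_DTilde h0 h1 hJ P
  have h3 := trace_mul_nonneg ((hPs.conj (L.loop K)).smul hγ.le) (hL.sigmaMat_posSemidef h0 hJ)
  rw [e, add_mul, trace_add] at h2
  have h4 : (L.gainCost K * L.SigmaMat γ K).trace ≤ γ / (1 - γ) * (P * L.DTilde).trace := by linarith
  rw [hL.J_eq h0 h1 hJ, mul_add, mul_div_cancel₀ _ hγ.ne']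
  have h5 := mul_le_mul_of_nonneg_left h4 hγ.le
  rw [← mul_assoc, mul_div_cancel₀ _ hγ.ne'] at h5
  nlinarith

end LQR


/-! ### The constants and the convergence rate. -/

/-- The factor `E` in the bound `E ε₀²` of the loss caused by an `ε₀`-approximation. -/
def lossFactor (σ r α j : ℝ) : ℝ := 4 * r * (1 + r * α ^ 2 * (2 * j / σ))

/-- The admissible accuracy constant of approximate policy iteration. -/
def accuracyConst (σ s r α _β j : ℝ) : ℝ :=
  -- The absolute value keeps this positive at all real arguments. Writing a for it, a ≤ (1 + a)² is
  -- all that is used; the 32 comes from the second bound of `approximation_loss_le`, through 4 / 32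
  -- = (1/2)³.
  1 / (1 + |32 * (lossFactor σ r α j * j) / (s ^ 3 * σ ^ 3)|)

theorem accuracyConst_pos (σ s r α β j : ℝ) : 0 < accuracyConst σ s r α β j := by
  unfold accuracyConst
  positivity

theorem accuracyConst_sq_mul_le {σ s : ℝ} (hσ : 0 < σ) (hs : 0 < s) (r α β j : ℝ) :
    accuracyConst σ s r α β j ^ 2 * (32 * (lossFactor σ r α j * j)) ≤ s ^ 3 * σ ^ 3 := by
  rw [accuracyConst]
  set F := 32 * (lossFactor σ r α j * j) with hF
  have hp : 0 < s ^ 3 * σ ^ 3 := by positivity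
  have h1 := le_abs_self (F / (s ^ 3 * σ ^ 3))
  have h2 := abs_nonneg (F / (s ^ 3 * σ ^ 3))
  set a := |F / (s ^ 3 * σ ^ 3)| with ha
  have h3 : F ≤ a * (s ^ 3 * σ ^ 3) := (div_le_iff₀ hp).mp h1
  rw [one_div, inv_pow, inv_mul_le_iff₀ (by positivity)]
  refine h3.trans (mul_le_mul_of_nonneg_right ?_ hp.le)
  nlinarith

/-- Squaring the accuracy condition gives ε₀² N Js² ≤ C² ε; the lower bounds N (1-γ) ≥ σ/2 and Js ≥
sσ/2 then remove N and Js where necessary. The first bound preserves stability, the second makes the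
error at most half of the contraction at level ε. -/
theorem approximation_loss_le {σ s r α β γ ε ε₀ N Js J₀ : ℝ} (hσ : 0 < σ) (hs : 0 < s) (hr : 0 < r)
    (h0 : 1 / 2 ≤ γ) (h1 : γ < 1) (hN : γ * σ / (1 - γ) ≤ N) (hJs : s * (γ * σ / (1 - γ)) ≤ Js)
    (hε : 0 < ε) (hεJ : ε ≤ J₀) (hε0 : 0 ≤ ε₀)
    (h : ε₀ ≤ accuracyConst σ s r α β ((1 - γ) * J₀) * √ε / (√N * Js)) :
    lossFactor σ r α ((1 - γ) * J₀) * ε₀ ^ 2 ≤ s / 2 ∧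
      lossFactor σ r α ((1 - γ) * J₀) * ε₀ ^ 2 * (2 * J₀ / s) ≤
        γ * σ / (1 - γ) / N / 2 * ε := by
  have hδ : 0 < 1 - γ := sub_pos.mpr h1
  have hγ : 0 < γ := by linarith
  have hJ0 : 0 < J₀ := hε.trans_le hεJ
  have hj : 0 < (1 - γ) * J₀ := mul_pos hδ hJ0
  have hC := accuracyConst_sq_mul_le hσ hs r α β ((1 - γ) * J₀)
  set C := accuracyConst σ s r α β ((1 - γ) * J₀) with hCdef
  set j := (1 - γ) * J₀ with hjdef
  have hE : 0 < lossFactor σ r α j := by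
    unfold lossFactor
    positivity
  set E := lossFactor σ r α j with hEdef
  set e := E * ε₀ ^ 2 with he
  have he0 : 0 ≤ e := by positivity
  have hq : σ / 2 ≤ γ * σ := by nlinarith
  have hN1 : σ / 2 ≤ N * (1 - γ) := hq.trans ((div_le_iff₀ hδ).mp hN)
  have hN0 : 0 < N := pos_of_mul_pos_left ((half_pos hσ).trans_le hN1) hδ.le
  have hJ1 : s * σ / 2 ≤ Js := by
    refine le_trans ?_ hJs
    have : σ / 2 ≤ γ * σ / (1 - γ) := by
      rw [le_div_iff₀ hδ]
      nlinarith
    nlinarith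
  have hJs0 : 0 < Js := lt_of_lt_of_le (by positivity) hJ1
  have hJ2 : (s * σ / 2) ^ 2 ≤ Js ^ 2 := pow_le_pow_left₀ (by positivity) hJ1 2
  have hsq : ε₀ ^ 2 * (N * Js ^ 2) ≤ C ^ 2 * ε := by
    have h2 := pow_le_pow_left₀ hε0 h 2
    rw [div_pow, mul_pow, mul_pow, Real.sq_sqrt hε.le, Real.sq_sqrt hN0.le,
      le_div_iff₀ (by positivity)] at h2
    exact h2
  have heN : e * (N * Js ^ 2) ≤ E * (C ^ 2 * ε) := by
    rw [he, mul_assoc]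
    exact mul_le_mul_of_nonneg_left hsq hE.le
  have hC2 : C ^ 2 * (E * j) ≤ s ^ 3 * σ ^ 3 / 32 := by linarith
  constructor
  · have a1 : s ^ 2 * σ ^ 3 / 8 ≤ N * (1 - γ) * Js ^ 2 := by
      calc _ = σ / 2 * (s * σ / 2) ^ 2 := by ring
        _ ≤ _ := mul_le_mul hN1 hJ2 (by positivity) (by positivity)
    have a2 : e * (s ^ 2 * σ ^ 3 / 8) ≤ s / 4 * (s ^ 2 * σ ^ 3 / 8) := by
      calc _ ≤ e * (N * (1 - γ) * Js ^ 2) := mul_le_mul_of_nonneg_left a1 he0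
        _ = e * (N * Js ^ 2) * (1 - γ) := by ring
        _ ≤ E * (C ^ 2 * J₀) * (1 - γ) := by
          refine mul_le_mul_of_nonneg_right (heN.trans ?_) hδ.le
          gcongr
        _ = C ^ 2 * (E * j) := by rw [hjdef]; ring
        _ ≤ _ := hC2.trans (le_of_eq (by ring))
    have a3 := le_of_mul_le_mul_right a2 (by positivity)
    linarith
  · have a1 : 4 * j * e * N * (s * σ / 2) ^ 2 ≤ s * σ / 2 * ε * (s * σ / 2) ^ 2 := by
      calc _ ≤ 4 * j * e * N * Js ^ 2 := mul_le_mul_of_nonneg_left hJ2 (by positivity)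
        _ = 4 * j * (e * (N * Js ^ 2)) := by ring
        _ ≤ 4 * j * (E * (C ^ 2 * ε)) := mul_le_mul_of_nonneg_left heN (by positivity)
        _ = 4 * ε * (C ^ 2 * (E * j)) := by ring
        _ ≤ 4 * ε * (s ^ 3 * σ ^ 3 / 32) := mul_le_mul_of_nonneg_left hC2 (by positivity)
        _ = _ := by ring
    have a2 := le_of_mul_le_mul_right a1 (by positivity)
    have a3 : s * σ / 2 * ε ≤ s * (γ * σ) * ε := by
      refine mul_le_mul_of_nonneg_right ?_ hε.le
      nlinarith
    rw [div_div, div_div, div_mul_eq_mul_div, mul_div_assoc', div_le_div_iff₀ hs (by positivity)]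
    calc _ = 4 * j * e * N := by rw [hjdef]; ring
      _ ≤ _ := a2.trans (a3.trans (le_of_eq (by ring)))

/-- A contraction with factor `1 - ρ / 2` reaches the accuracy `ε` after `(2 / ρ) log (Δ / ε)`
steps. -/
theorem one_sub_half_pow_mul_le {ρ Δ ε : ℝ} (hρ : 0 < ρ) (hρ1 : ρ ≤ 1) (hε : 0 < ε) (hΔ : 0 < Δ)
    {T : ℕ} (hT : 2 / ρ * Real.log (Δ / ε) ≤ T) : (1 - ρ / 2) ^ T * Δ ≤ ε := by
  have h1 : (1 - ρ / 2) ^ T ≤ Real.exp (-(ρ / 2)) ^ T :=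
    pow_le_pow_left₀ (by linarith) (Real.one_sub_le_exp_neg _) T
  rw [← Real.exp_nat_mul] at h1
  have h2 : (T : ℝ) * -(ρ / 2) ≤ -Real.log (Δ / ε) := by
    have := mul_le_mul_of_nonneg_right hT (half_pos hρ).le
    have e : 2 / ρ * Real.log (Δ / ε) * (ρ / 2) = Real.log (Δ / ε) := by field_simp
    linarith
  have h3 := h1.trans (Real.exp_le_exp.mpr h2)
  rw [Real.exp_neg, Real.exp_log (by positivity), inv_div] at h3
  calc _ ≤ ε / Δ * Δ := mul_le_mul_of_nonneg_right h3 hΔ.le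
    _ = ε := div_mul_cancel₀ _ hΔ.ne'

/-- With z = N/(γ²σ) ≥ 1 the left side is 2zγ(1-γ) ≤ z/2, which is at most 2z - 1. -/
theorem two_div_rate_le {γ σ N : ℝ} (hσ : 0 < σ) (hγ : 0 < γ) (h1 : γ < 1)
    (hN : γ * σ / (1 - γ) ≤ N) :
    2 / (γ * σ / (1 - γ) / N) ≤ 2 * N / (γ ^ 2 * σ) - 1 := by
  have hδ : 0 < 1 - γ := sub_pos.mpr h1
  have hN2 : γ * σ ≤ N := (le_div_self (by positivity) hδ (by linarith)).trans hN
  have hN0 : 0 < N := lt_of_lt_of_le (by positivity) hN2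
  have hz : 1 ≤ N / (γ ^ 2 * σ) := by
    rw [one_le_div (by positivity)]
    nlinarith [mul_pos hγ hσ]
  have e1 : 2 / (γ * σ / (1 - γ) / N) = 2 * (N / (γ ^ 2 * σ)) * (γ * (1 - γ)) := by
    field_simp
  rw [e1, mul_div_assoc]
  nlinarith [sq_nonneg (γ - 1 / 2)]

/-! ### Induction along the run. -/

theorem theorem4p1 :
    ∃ C₁ : ℝ → ℝ → ℝ → ℝ → ℝ → ℝ → ℝ,
      (∀ a b c p q j, 0 < C₁ a b c p q j) ∧
      ∀ (n d : ℕ) (Ω : Type*) [MeasurableSpace Ω] (L : LQR n d Ω), L.Standing →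
      ∀ K₀ : Matrix (Fin d) (Fin n) ℝ, L.Stable K₀ →
      ∃ γ₀ ∈ Set.Ioo (0 : ℝ) 1, ∀ γ ∈ Set.Ioo γ₀ 1,
      ∀ Kstar : Matrix (Fin d) (Fin n) ℝ, L.IsOptimal γ Kstar →
      ∀ ε : ℝ, 0 < ε → ε ≤ L.J γ K₀ - L.J γ Kstar →
      ∀ ε₀ : ℝ,
        ε₀ ≤ min (1 / (2 * specNorm L.R⁻¹))
          (C₁ (sigmaMin L.DTilde) (sigmaMin L.S) (specNorm L.R⁻¹) (specNorm L.A) (specNorm L.B)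
              ((1 - γ) * L.J γ K₀) * √ε
            / (√(specNorm (L.SigmaMat γ Kstar)) * L.J γ Kstar)) →
      ∀ T : ℕ,
        (2 * specNorm (L.SigmaMat γ Kstar) / (γ ^ 2 * sigmaMin L.DTilde) - 1)
          * Real.log ((L.J γ K₀ - L.J γ Kstar) / ε) ≤ (T : ℝ) →
      ∀ (K : ℕ → Matrix (Fin d) (Fin n) ℝ)
        (Θ : ℕ → Matrix (Fin n ⊕ Fin d) (Fin n ⊕ Fin d) ℝ),
        K 0 = K₀ → L.IsPolicyIteration γ ε₀ T K Θ →
        (∀ s < T, IsUnit (Θ s).toBlocks₂₂.det) ∧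
        (∀ s, 1 ≤ s → s ≤ T → L.Stable (K s) ∧ K s ∈ L.DomLevel γ Kstar K₀ 2) ∧
        L.J γ (K T) - L.J γ Kstar ≤ ε := by
  refine ⟨accuracyConst, accuracyConst_pos, fun n d Ω _ L hL K₀ hK₀ => ?_⟩
  -- If only one gain exists, then K₀ = K* and 0 < ε ≤ 0 is impossible; otherwise both dimensions
  -- are positive.
  by_cases hnd : Subsingleton (Matrix (Fin d) (Fin n) ℝ)
  · refine ⟨1 / 2, ⟨by norm_num, by norm_num⟩, fun γ _ Kstar _ ε hε hεJ => ?_⟩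
    rw [Subsingleton.elim K₀ Kstar, sub_self] at hεJ
    exact absurd hεJ (not_le.mpr hε)
  have hn : Nonempty (Fin n) := by
    by_contra h
    have := not_nonempty_iff.mp h
    exact hnd ⟨fun M N => by ext i j; exact isEmptyElim j⟩
  have hd : Nonempty (Fin d) := by
    by_contra h
    have := not_nonempty_iff.mp h
    exact hnd ⟨fun M N => by ext i j; exact isEmptyElim i⟩
  obtain ⟨M, hM0, hM⟩ := hL.exists_average_cost_bound hK₀
  have hσ := sigmaMin_pos hL.posDef_DTilde
  have hs := sigmaMin_pos hL.posDef_S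
  set σ := sigmaMin L.DTilde with hσdef
  have hw : 0 < sigmaMin L.S * σ / (8 * (M + 1)) := by positivity
  -- Chosen so that (1-γ) · 2(M+1)/σ ≤ s/4, the slack required for stability; M + 1 avoids division
  -- by zero, and γ ≥ 1/2 absorbs factors 1/γ.
  refine ⟨max (1 / 2) (1 - sigmaMin L.S * σ / (8 * (M + 1))),
    ⟨lt_max_of_lt_left (by norm_num), max_lt (by norm_num) (by linarith)⟩,
    fun γ ⟨hγ0, h1⟩ Kstar hopt ε hε hεJ ε₀ hε₀ T hT K Θ hK0 hrun => ?_⟩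
  have h0 : 1 / 2 ≤ γ := (le_max_left _ _).trans hγ0.le
  have hγM : 1 - γ ≤ sigmaMin L.S * σ / (8 * (M + 1)) := by
    linarith [(le_max_right _ _).trans hγ0.le]
  have hγ : 0 < γ := by linarith
  have hδ : 0 < 1 - γ := sub_pos.mpr h1
  have hJ₀ := hL.JExt_ne_top_of_stable hγ.le h1 hK₀
  have hJs : L.JExt γ Kstar ≠ ∞ := ne_top_of_le_ne_top hJ₀ (hopt K₀)
  have hN := hL.le_specNorm_sigmaMat hγ.le h1 hJs
  have hJs' := hL.le_J hγ.le h1 hJs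
  set N := specNorm (L.SigmaMat γ Kstar) with hNdef
  set J₀ := L.J γ K₀ with hJ₀def
  set Js := L.J γ Kstar with hJsdef
  have hjM : (1 - γ) * J₀ ≤ M := hM γ hγ.le h1
  have hJspos : 0 ≤ Js := ENNReal.toReal_nonneg
  have hq : 0 < γ * σ / (1 - γ) := by positivity
  have hNpos : 0 < N := hq.trans_le hN
  set ρ := γ * σ / (1 - γ) / N with hρdef
  have hρ : 0 < ρ := by positivity
  have hρ1 : ρ ≤ 1 := (div_le_one hNpos).mpr hN
  have hjγ : (1 - γ) * (2 * ((1 - γ) * J₀) / σ) ≤ sigmaMin L.S / 4 := by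
    have a1 : 2 * ((1 - γ) * J₀) / σ ≤ 2 * (M + 1) / σ := by gcongr; linarith
    calc _ ≤ (1 - γ) * (2 * (M + 1) / σ) := mul_le_mul_of_nonneg_left a1 hδ.le
      _ ≤ sigmaMin L.S * σ / (8 * (M + 1)) * (2 * (M + 1) / σ) :=
        mul_le_mul_of_nonneg_right hγM (by positivity)
      _ = _ := by
        field_simp
        norm_num
  have hr := specNorm_inv_pos hL.posDef_R
  have hε₁ := hε₀.trans (min_le_left _ _)
  have hε₂ := hε₀.trans (min_le_right _ _)
  have hΔ : 0 < J₀ - Js := hε.trans_le hεJ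
  have hstep : ∀ s < T, L.Stable (K s) → L.J γ (K s) ≤ J₀ →
      IsUnit (Θ s).toBlocks₂₂.det ∧ L.Stable (K (s + 1)) ∧
        L.J γ (K (s + 1)) - Js ≤ (1 - ρ) * (L.J γ (K s) - Js) + ρ / 2 * ε := by
    intro s hsT hst hJK
    have happ := (hrun s hsT).1 hst
    -- The sign of ε₀ is not assumed; it follows from the existence of an approximation.
    have hε0 : 0 ≤ ε₀ := by
      obtain ⟨_, _, -, h⟩ := happ
      exact (frobNorm_nonneg _).trans h
    obtain ⟨l1, l2⟩ := approximation_loss_le hσ hs hr h0 h1 hN hJs' hε (hεJ.trans (by linarith))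
      hε0 hε₂
    rw [(hrun s hsT).2]
    -- The parameter j stays (1-γ) J(K₀) along the whole run, and `le_rfl` sets e to `lossFactor`
    -- times ε₀².
    obtain ⟨a1, a2, a3⟩ := hL.policy_step h0 h1 hst hJs (mul_le_mul_of_nonneg_left hJK hδ.le) hjγ
      hε₁ le_rfl l1 happ
    refine ⟨a1, a2, a3.trans (add_le_add le_rfl (le_trans ?_ l2))⟩
    refine mul_le_mul_of_nonneg_left (by gcongr) ?_
    have : 0 ≤ J₀ := by linarith
    positivity
  have hρ2 : 0 ≤ 1 - ρ / 2 := by linarith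
  -- While the bound X exceeds ε, the error ρε/2 is absorbed by half of the contraction; once it is
  -- below ε, (1-ρ)ε + ρε/2 ≤ ε keeps it there. The cost thus never exceeds J(K₀), as `hstep`
  -- requires.
  have hind : ∀ s ≤ T, L.Stable (K s) ∧
      L.J γ (K s) - Js ≤ max ε ((1 - ρ / 2) ^ s * (J₀ - Js)) := by
    intro s
    induction s with
    | zero =>
      intro _
      rw [hK0]
      exact ⟨hK₀, le_max_of_le_right (by simp [J₀])⟩
    | succ s ih =>
      intro hsT
      obtain ⟨i1, i2⟩ := ih (by lia)
      have hpow : (1 - ρ / 2) ^ s * (J₀ - Js) ≤ J₀ - Js :=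
        mul_le_of_le_one_left hΔ.le (pow_le_one₀ hρ2 (by linarith))
      have hJK : L.J γ (K s) ≤ J₀ := by linarith [max_le hεJ hpow]
      obtain ⟨-, b2, b3⟩ := hstep s (by lia) i1 hJK
      refine ⟨b2, b3.trans ?_⟩
      have i3 := mul_le_mul_of_nonneg_left i2 (sub_nonneg.mpr hρ1)
      set X := (1 - ρ / 2) ^ s * (J₀ - Js) with hX
      have hX' : (1 - ρ / 2) ^ (s + 1) * (J₀ - Js) = (1 - ρ / 2) * X := by rw [hX]; ring
      rw [hX']
      rcases le_total ε X with h | h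
      · rw [max_eq_right h] at i3
        refine le_max_of_le_right ?_
        linarith [mul_nonneg hρ.le (sub_nonneg.mpr h)]
      · rw [max_eq_left h] at i3
        refine le_max_of_le_left ?_
        linarith [mul_pos hρ hε]
  have hle : ∀ s ≤ T, L.J γ (K s) - Js ≤ J₀ - Js := fun s hsT =>
    (hind s hsT).2.trans (max_le hεJ
      (mul_le_of_le_one_left hΔ.le (pow_le_one₀ hρ2 (by linarith))))
  refine ⟨fun s hsT => (hstep s hsT (hind s hsT.le).1 (by linarith [hle s hsT.le])).1,
    fun s _ hsT => ⟨(hind s hsT).1, hL.JExt_ne_top_of_stable hγ.le h1 (hind s hsT).1, ?_⟩, ?_⟩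
  -- The excess stays below its initial value, so the level set with factor 1 already contains the
  -- iterates.
  · exact (hle s hsT).trans (by linarith)
  · refine (hind T le_rfl).2.trans (max_le le_rfl (one_sub_half_pow_mul_le hρ hρ1 hε hΔ ?_))
    refine le_trans (mul_le_mul_of_nonneg_right ?_ (Real.log_nonneg ?_)) hT
    · exact two_div_rate_le hσ hγ h1 hN
    · rwa [one_le_div hε]

end
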